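/- Let $(M,d)$ be a (nonempty) global NPC space, i.e. a complete metric space in which any $x,y$ have a point $m$ with $d^2(z,m)\le\frac12d^2(z,x)+\frac12d^2(z,y)-\frac14d^2(x,y)$ for all $z\in M$. For $x,y\in M$ and $t\in[0,1]$ let $x\#_ty$ be the point $\gamma(t)$ of the unique minimal geodesic $\gamma:[0,1]\to M$ from $x$ to $y$. Let $\mathcal P^1(M)$ be the set of Borel probability measures $\mu$ on $M$ with $\mu(\operatorname{supp}\mu)=1$ and $\int d(x,y)\,d\mu(y)<\infty$ for some $x$, with the $1$-Wasserstein distance $d_1^W(\mu,\nu)=\inf_\pi\int d(x,y)\,d\pi(x,y)$, the infimum being over all couplings $\pi$ of $\mu$ and $\nu$. Let $\mathcal C_1(M)$ be the set of maps $\beta:\mathcal P^1(M)\to M$ with $\beta(\delta_x)=x$ for all $x\in M$ and $d(\beta(\mu),\beta(\nu))\le d_1^W(\mu,\nu)$ for all $\mu,\nu\in\mathcal P^1(M)$. Let $$\lambda(\mu)=\operatorname*{arg\,min}_{z\in M}\int_M\bigl[d^2(z,x)-d^2(y,x)\bigr]\,d\mu(x)\qquad(\mu\in\mathcal P^1(M)),$$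 independently of $y\in M$. For $\beta\in\mathcal C_1(M)$, $t\in(0,1]$ and $\mu\in\mathcal P^1(M)$ let $\beta_t(\mu)=\Phi_1(t,\beta)(\mu)$ be the unique $x\in M$ with $x=\beta(x\#_t\mu)$, where $x\#_t\mu$ is the image of $\mu$ under $a\mapsto x\#_ta$. Let $(\Omega,\mathcal A,\mathbf P)$ be a probability space and $T:\Omega\to\Omega$ a $\mathbf P$-preserving measurable map. Let $L^1(\Omega;M)$ be the set of strongly measurable $\varphi:\Omega\to M$ with $\int d(x,\varphi(\omega))\,d\mathbf P(\omega)<\infty$ for some $x\in M$, with $\mathbf d_1(\varphi,\psi)=\int d(\varphi(\omega),\psi(\omega))\,d\mathbf P(\omega)$. For $\beta\in\mathcal C_1(M)$ and $\varphi\in L^1(\Omega;M)$ let $E^\beta(\varphi)=\beta(\varphi_*\mathbf P)$ and $$\Gamma_\beta(\varphi)(\omega)=\lim_{n\to\infty}\beta\bigl(\mu_n^\varphi(\omega)\bigr),\qquad \mu_n^\varphi(\omega)=\frac1n\sum_{k=0}^{n-1}\delta_{\varphi(T^k\omega)} .$$ **Corollary.** Let $\beta\in\mathcal C_1(M)$.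 Then the objects above are well defined: minimal geodesics exist and are unique; the minimizer $\lambda(\mu)$ exists and is unique, and $\lambda\in\mathcal C_1(M)$; the fixed point $\beta_t(\mu)$ exists and is unique, and $\beta_t\in\mathcal C_1(M)$ for all $t\in(0,1]$. Moreover, for every $\varphi\in L^1(\Omega;M)$: 1. For each $\alpha\in\{\lambda\}\cup\{\beta_t:t\in(0,1]\}$ the limit $\Gamma_\alpha(\varphi)$ exists a.e. and in $\mathbf d_1$, and belongs to $L^1(\Omega;M)$; the pointwise limits $\Gamma_{\beta_t}(\varphi)(\omega)$, $t\in(0,1]$, exist simultaneously off one null set that does not depend on $t$. 2. As $t\to0^+$, $\mathbf d_1\bigl(\Gamma_{\beta_t}(\varphi),\Gamma_\lambda(\varphi)\bigr)\to0$. 3. For a.e. $\omega$, $d\bigl(\Gamma_{\beta_t}(\varphi)(\omega),\Gamma_\lambda(\varphi)(\omega)\bigr)\to0$ as $t\to0^+$. 4. If $T$ is ergodic, then $\lim_{t\to0^+}E^{\beta_t}(\varphi)=E^\lambda(\varphi)$. -/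

import Mathlib

open MeasureTheory Filter Topology Set
open scoped ENNReal

noncomputable section

/-! ### Global NPC spaces and their geodesics -/

/-- A global NPC space (Hadamard space): a complete metric space in which any two points
`x`, `y` have a point `m` with
`d(z,m)² ≤ d(z,x)²/2 + d(z,y)²/2 - d(x,y)²/4` for all `z`. -/
structure IsGlobalNPC (M : Type*) [MetricSpace M] : Prop where
  complete : CompleteSpace M
  exists_mid : ∀ x y : M, ∃ m : M, ∀ z : M,
    dist z m ^ 2 ≤ dist z x ^ 2 / 2 + dist z y ^ 2 / 2 - dist x y ^ 2 / 4

/-- `γ`, restricted to `[0,1]`, is a minimal geodesic of constant speed from `x` to `y`. -/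
def IsMinimalGeodesic {M : Type*} [MetricSpace M] (x y : M) (γ : ℝ → M) : Prop :=
  γ 0 = x ∧ γ 1 = y ∧
    ∀ s ∈ Icc (0 : ℝ) 1, ∀ t ∈ Icc (0 : ℝ) 1, dist (γ s) (γ t) = |s - t| * dist x y

/-- The point `x #_t y` at parameter `t ∈ [0,1]` on the minimal geodesic from `x` to `y`
(unique in a global NPC space). -/
def geodesicPoint {M : Type*} [MetricSpace M] [Nonempty M] (x y : M) (t : ℝ) : M :=
  Classical.epsilon (fun γ : ℝ → M => IsMinimalGeodesic x y γ) t

/-! ### Integrable probability measures and contractive barycentric maps -/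

/-- The set `𝒫¹(M)` of Borel probability measures that are carried by their support and have
finite first moment. -/
def P1 (M : Type*) [MetricSpace M] [MeasurableSpace M] : Set (Measure M) :=
  {μ | IsProbabilityMeasure μ ∧ μ (μ.support)ᶜ = 0 ∧ ∃ x : M, ∫⁻ y, edist x y ∂μ < ∞}

/-- The `1`-Wasserstein distance, as the infimum of the transport cost over all couplings.
Measures in `𝒫¹(M)` live on closed separable sets; on a product of two such sets the product
σ-algebra is the Borel σ-algebra, so it makes no difference which of the two the couplings
are defined on. -/
def wasserstein1 {M : Type*} [MetricSpace M] [MeasurableSpace M] (μ ν : Measure M) : ℝ≥0∞ :=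
  ⨅ (π : Measure (M × M)) (_ : π.map Prod.fst = μ ∧ π.map Prod.snd = ν),
    ∫⁻ p, edist p.1 p.2 ∂π

/-- `β ∈ 𝒞₁(M)`: `β` is a (`1`-)contractive barycentric map on `𝒫¹(M)`. As usual a map with
domain `𝒫¹(M)` is given by a total function whose values off `𝒫¹(M)` play no role. -/
def IsContractiveBarycentricMap {M : Type*} [MetricSpace M] [MeasurableSpace M]
    (β : Measure M → M) : Prop :=
  (∀ x : M, β (Measure.dirac x) = x) ∧
    ∀ μ ∈ P1 M, ∀ ν ∈ P1 M, edist (β μ) (β ν) ≤ wasserstein1 μ ν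

/-- `z` minimizes `z ↦ ∫ [d(z,x)² - d(y,x)²] dμ(x)` (for every choice of the base point `y`). -/
def IsCanonicalBarycenter {M : Type*} [MetricSpace M] [MeasurableSpace M]
    (μ : Measure M) (z : M) : Prop :=
  ∀ y w : M, ∫ x, (dist z x ^ 2 - dist y x ^ 2) ∂μ ≤ ∫ x, (dist w x ^ 2 - dist y x ^ 2) ∂μ

/-- The canonical barycentric map `λ` of a global NPC space,
`λ(μ) = argmin_z ∫ [d(z,x)² - d(y,x)²] dμ(x)`. -/
def canonicalBarycenter {M : Type*} [MetricSpace M] [MeasurableSpace M] [Nonempty M]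
    (μ : Measure M) : M :=
  Classical.epsilon (fun z : M => IsCanonicalBarycenter μ z)

/-- The measure `x #_t μ`, the image of `μ` under `a ↦ x #_t a`. -/
def geodesicPush {M : Type*} [MetricSpace M] [MeasurableSpace M] [Nonempty M]
    (x : M) (t : ℝ) (μ : Measure M) : Measure M :=
  μ.map (fun a => geodesicPoint x a t)

/-- The semiflow `Φ₁`: for `t ∈ (0,1]`, `Φ₁(t,β)(μ)` is the (unique) solution `x` of
`x = β(x #_t μ)`. -/
def barycenterFlow {M : Type*} [MetricSpace M] [MeasurableSpace M] [Nonempty M]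
    (t : ℝ) (β : Measure M → M) (μ : Measure M) : M :=
  Classical.epsilon (fun x : M => x = β (geodesicPush x t μ))

/-! ### Integrable `M`-valued functions, expectations and ergodic limits -/

/-- `φ ∈ L¹(Ω;M)`. -/
def MemL1 {Ω M : Type*} [MeasurableSpace Ω] [MetricSpace M] (P : Measure Ω) (φ : Ω → M) : Prop :=
  AEStronglyMeasurable φ P ∧ ∃ x : M, ∫⁻ ω, edist x (φ ω) ∂P < ∞

/-- The `L¹`-distance `𝐝₁(φ,ψ) = ∫ d(φ(ω),ψ(ω)) dP(ω)`. -/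
def distL1 {Ω M : Type*} [MeasurableSpace Ω] [MetricSpace M] (P : Measure Ω) (φ ψ : Ω → M) :
    ℝ≥0∞ :=
  ∫⁻ ω, edist (φ ω) (ψ ω) ∂P

/-- The `β`-expectation `E^β(φ) = β(φ_* P)`. -/
def barycentricExpectation {Ω M : Type*} [MeasurableSpace Ω] [MeasurableSpace M]
    (P : Measure Ω) (β : Measure M → M) (φ : Ω → M) : M :=
  β (P.map φ)

/-- The empirical measure `μ_n^φ(ω) = (1/n) ∑_{k<n} δ_{φ(T^k ω)}`, `n ≥ 1`. -/
def empiricalMeasure {Ω M : Type*} [MeasurableSpace M] (T : Ω → Ω) (φ : Ω → M)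
    (n : ℕ) (ω : Ω) : Measure M :=
  (n : ℝ≥0∞)⁻¹ • ∑ k ∈ Finset.range n, Measure.dirac (φ (T^[k] ω))

/-- `g` is an ergodic limit function of `φ` for `β`: `g ∈ L¹(Ω;M)` and `β(μ_n^φ) → g` both
almost everywhere and in `L¹`. -/
def IsErgodicLimit {Ω M : Type*} [MeasurableSpace Ω] [MetricSpace M] [MeasurableSpace M]
    (P : Measure Ω) (T : Ω → Ω) (β : Measure M → M) (φ g : Ω → M) : Prop :=
  MemL1 P g ∧
  (∀ᵐ ω ∂P, Tendsto (fun n : ℕ => β (empiricalMeasure T φ n ω)) atTop (𝓝 (g ω))) ∧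
  Tendsto (fun n : ℕ => distL1 P (fun ω => β (empiricalMeasure T φ n ω)) g) atTop (𝓝 0)

/-- The ergodic limit function `Γ_β(φ)(ω) = lim_n β(μ_n^φ(ω))`. -/
def ergodicLimit {Ω M : Type*} [MetricSpace M] [MeasurableSpace M] [Nonempty M]
    (T : Ω → Ω) (β : Measure M → M) (φ : Ω → M) (ω : Ω) : M :=
  limUnder atTop (fun n : ℕ => β (empiricalMeasure T φ n ω))

end

/-!
In a global NPC space the midpoint inequality propagates to all parameters `t ∈ [0,1]`, which gives
the geodesics, the convexity of the metric, Reshetnyak's quadruple comparison and the variance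
inequality `d(z,λ(μ))² ≤ ∫ [d(z,x)² - d(λ(μ),x)²] dμ(x)`; the last two make `λ` contractive. By
convexity of the metric, `x ↦ β(x #_t μ)` is a contraction of ratio `1 - t`, whose fixed point is
`β_t(μ)`.

If `μ` has bounded support, then comparing `β_t(μ)` with `λ(μ)` by means of the variance inequality
and the fixed point equation shows that their distance is `O(√t)`. Since such measures are dense
and all the maps are contractive, `β_t → λ` pointwise on `𝒫¹(M)`; at `φ_* P` this is the convergence
of the expectations.

For the ergodic limits, Birkhoff's theorem for the simple functions approximating `φ` and the
maximal inequality show that the empirical measures along almost every orbit are Cauchy, uniformly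
with respect to all contractive barycentric maps: this is the null set common to all `t`. A limit
in `t` is thereby reduced to the limit at a single empirical measure. Moreover `φ ↦ Γ_α(φ)` is a
contraction of `L¹`, so that the convergence in `L¹` needs to be checked for simple functions only,
where it is dominated.
-/

/-! ### Geometry of global NPC spaces -/

section Geometry

/-- A closed set of reals that is stable under midpoints is convex: the endpoints of a gap
would have their midpoint in the gap. -/
lemma Icc_subset_of_isClosed_of_half_add_mem {S : Set ℝ} (hS : IsClosed S)
    (hmid : ∀ a ∈ S, ∀ b ∈ S, (a + b) / 2 ∈ S) {a b : ℝ} (ha : a ∈ S) (hb : b ∈ S) :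
    Icc a b ⊆ S := by
  intro t ht
  by_contra htS
  have hbdd_left : BddAbove (S ∩ Iic t) := ⟨t, fun _ h => h.2⟩
  have hbdd_right : BddBelow (S ∩ Ici t) := ⟨t, fun _ h => h.2⟩
  obtain ⟨hl, hlt⟩ := (hS.inter isClosed_Iic).csSup_mem ⟨a, ha, ht.1⟩ hbdd_left
  obtain ⟨hr, htr⟩ := (hS.inter isClosed_Ici).csInf_mem ⟨b, hb, ht.2⟩ hbdd_right
  have hlt' : sSup (S ∩ Iic t) < t := lt_of_le_of_ne hlt fun h => htS (h ▸ hl)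
  have htr' : t < sInf (S ∩ Ici t) := lt_of_le_of_ne htr fun h => htS (h ▸ hr)
  have hm := hmid _ hl _ hr
  rcases le_total ((sSup (S ∩ Iic t) + sInf (S ∩ Ici t)) / 2) t with h | h
  · linarith [le_csSup hbdd_left ⟨hm, h⟩]
  · linarith [csInf_le hbdd_right ⟨hm, h⟩]

variable {M : Type*} [MetricSpace M]

/-- `m` satisfies the NPC comparison inequality for the parameter `t` between `x` and `y`.
In a global NPC space this characterizes the point `x #_t y`. -/
def IsNPCPoint (x y : M) (t : ℝ) (m : M) : Prop :=
  ∀ z : M, dist z m ^ 2 ≤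
    (1 - t) * dist z x ^ 2 + t * dist z y ^ 2 - t * (1 - t) * dist x y ^ 2

namespace IsNPCPoint

variable {x y m m' : M} {s t : ℝ}

lemma dist_le_of_dist_le (hs : s ∈ Icc (0 : ℝ) 1) (hm : IsNPCPoint x y s m)
    (hx : dist m' x ≤ t * dist x y) (hy : dist m' y ≤ (1 - t) * dist x y) :
    dist m' m ≤ |t - s| * dist x y := by
  have hx_sq := mul_le_mul_of_nonneg_left (pow_le_pow_left₀ dist_nonneg hx 2) (sub_nonneg.2 hs.2)
  have hy_sq := mul_le_mul_of_nonneg_left (pow_le_pow_left₀ dist_nonneg hy 2) hs.1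
  refine abs_le_of_sq_le_sq' ?_ (by positivity) |>.2
  rw [mul_pow, sq_abs]
  linarith [hm m']

lemma dist_left_le (ht : t ∈ Icc (0 : ℝ) 1) (hm : IsNPCPoint x y t m) :
    dist m x ≤ t * dist x y := by
  have := hm.dist_le_of_dist_le (m' := x) (t := 0) ht (by simp) (by simp)
  rwa [zero_sub, abs_neg, abs_of_nonneg ht.1, dist_comm] at this

lemma dist_right_le (ht : t ∈ Icc (0 : ℝ) 1) (hm : IsNPCPoint x y t m) :
    dist m y ≤ (1 - t) * dist x y := by
  have := hm.dist_le_of_dist_le (m' := y) (t := 1) ht (by simp [dist_comm]) (by simp)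
  rwa [abs_of_nonneg (sub_nonneg.2 ht.2), dist_comm] at this

lemma dist_eq (hs : s ∈ Icc (0 : ℝ) 1) (ht : t ∈ Icc (0 : ℝ) 1) (hm : IsNPCPoint x y s m)
    (hm' : IsNPCPoint x y t m') : dist m m' = |s - t| * dist x y := by
  have hmx := hm.dist_left_le hs
  have hmy := hm.dist_right_le hs
  have hmx' := hm'.dist_left_le ht
  have hmy' := hm'.dist_right_le ht
  refine le_antisymm (hm'.dist_le_of_dist_le ht hmx hmy) ?_
  have hthrough := dist_triangle4 x m m' y
  have hthrough' := dist_triangle4 x m' m y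
  rw [dist_comm x m] at hthrough
  rw [dist_comm x m', dist_comm m' m] at hthrough'
  rcases abs_cases (s - t) with ⟨h, -⟩ | ⟨h, -⟩ <;> rw [h] <;> linarith

lemma unique (ht : t ∈ Icc (0 : ℝ) 1) (hm : IsNPCPoint x y t m) (hm' : IsNPCPoint x y t m') :
    m = m' := by
  simpa using hm.dist_eq ht ht hm'

lemma symm (hm : IsNPCPoint x y t m) : IsNPCPoint y x (1 - t) m := by
  intro z
  rw [dist_comm y x]
  linarith [hm z]

end IsNPCPoint

lemma isClosed_setOf_exists_isNPCPoint [CompleteSpace M] (x y : M) :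
    IsClosed {t | t ∈ Icc (0 : ℝ) 1 ∧ ∃ m, IsNPCPoint x y t m} := by
  rw [← isSeqClosed_iff_isClosed]
  intro u t hu hut
  choose hu_mem m hm using hu
  have hcauchy : CauchySeq m := by
    have hu_cauchy := cauchySeq_iff_tendsto_dist_atTop_0.1 hut.cauchySeq
    rw [cauchySeq_iff_tendsto_dist_atTop_0]
    simpa [(hm _).dist_eq (hu_mem _) (hu_mem _) (hm _), Real.dist_eq] using
      hu_cauchy.mul_const (dist x y)
  obtain ⟨p, hp⟩ := cauchySeq_tendsto_of_complete hcauchy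
  refine ⟨isClosed_Icc.mem_of_tendsto hut (.of_forall hu_mem), p, fun z => ?_⟩
  refine le_of_tendsto_of_tendsto' ((tendsto_const_nhds.dist hp).pow 2) ?_ fun n => hm n z
  exact (((tendsto_const_nhds.sub hut).mul_const _).add (hut.mul_const _)).sub
    ((hut.mul (tendsto_const_nhds.sub hut)).mul_const _)

namespace IsGlobalNPC

lemma exists_isNPCPoint_half_add (hM : IsGlobalNPC M) {x y m m' : M} {s t : ℝ}
    (hs : s ∈ Icc (0 : ℝ) 1) (ht : t ∈ Icc (0 : ℝ) 1) (hm : IsNPCPoint x y s m)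
    (hm' : IsNPCPoint x y t m') : ∃ p, IsNPCPoint x y ((s + t) / 2) p := by
  obtain ⟨p, hp⟩ := hM.exists_mid m m'
  refine ⟨p, fun z => ?_⟩
  have h := hp z
  rw [hm.dist_eq hs ht hm', mul_pow, sq_abs] at h
  linarith [hm z, hm' z]

lemma exists_isNPCPoint (hM : IsGlobalNPC M) (x y : M) {t : ℝ} (ht : t ∈ Icc (0 : ℝ) 1) :
    ∃ m, IsNPCPoint x y t m := by
  have := hM.complete
  refine (Icc_subset_of_isClosed_of_half_add_mem (isClosed_setOf_exists_isNPCPoint x y) ?_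
    ⟨by simp, x, fun z => by simp⟩ ⟨by simp, y, fun z => by simp⟩ ht).2
  rintro r ⟨hr, p, hp⟩ s ⟨hs, q, hq⟩
  exact ⟨⟨by linarith [hr.1, hs.1], by linarith [hr.2, hs.2]⟩,
    hM.exists_isNPCPoint_half_add hr hs hp hq⟩

lemma exists_isMinimalGeodesic (hM : IsGlobalNPC M) (x y : M) :
    ∃ γ : ℝ → M, IsMinimalGeodesic x y γ := by
  have : Nonempty M := ⟨x⟩
  choose! γ hγ using fun t => hM.exists_isNPCPoint x y (t := t)
  refine ⟨γ, ?_, ?_, fun s hs t ht => (hγ s hs).dist_eq hs ht (hγ t ht)⟩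
  · simpa using (hγ 0 (by simp)).dist_left_le (by simp)
  · simpa using (hγ 1 (by simp)).dist_right_le (by simp)

end IsGlobalNPC

lemma IsMinimalGeodesic.isNPCPoint (hM : IsGlobalNPC M) {x y : M} {γ : ℝ → M}
    (hγ : IsMinimalGeodesic x y γ) {t : ℝ} (ht : t ∈ Icc (0 : ℝ) 1) :
    IsNPCPoint x y t (γ t) := by
  obtain ⟨m, hm⟩ := hM.exists_isNPCPoint x y ht
  have hx := hγ.2.2 t ht 0 (by simp)
  have hy := hγ.2.2 t ht 1 (by simp)
  rw [hγ.1, sub_zero, abs_of_nonneg ht.1] at hx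
  rw [hγ.2.1, abs_sub_comm, abs_of_nonneg (sub_nonneg.2 ht.2)] at hy
  have hγm : γ t = m := by simpa using hm.dist_le_of_dist_le ht hx.le hy.le
  rwa [hγm]

lemma add_sq_le_sq_div_add_sq_div {t : ℝ} (ht : t ∈ Ioo (0 : ℝ) 1) (u v : ℝ) :
    (u + v) ^ 2 ≤ u ^ 2 / t + v ^ 2 / (1 - t) := by
  have ht0 := ht.1
  have ht1 := sub_pos.2 ht.2
  have hdiff : u ^ 2 / t + v ^ 2 / (1 - t) - (u + v) ^ 2 =
      ((1 - t) * u - t * v) ^ 2 / (t * (1 - t)) := by field_simp; ring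
  have : 0 ≤ ((1 - t) * u - t * v) ^ 2 / (t * (1 - t)) := by positivity
  linarith

namespace IsGlobalNPC

lemma sq_dist_add_sq_dist_le_weighted (hM : IsGlobalNPC M) (x y p q : M) {t : ℝ}
    (ht : t ∈ Ioo (0 : ℝ) 1) :
    dist y p ^ 2 + dist x q ^ 2 ≤ dist x p ^ 2 + dist y q ^ 2 +
      ((1 - t) / t * dist x y ^ 2 + t / (1 - t) * dist p q ^ 2) := by
  have ht0 := ht.1
  have ht1 := sub_pos.2 ht.2
  obtain ⟨m, hm⟩ := hM.exists_isNPCPoint x q ⟨ht0.le, ht.2.le⟩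
  have hy := div_le_div_of_nonneg_right (hm y) ht0.le
  have hp := div_le_div_of_nonneg_right (hm p) ht1.le
  calc dist y p ^ 2 + dist x q ^ 2 ≤ (dist y m + dist p m) ^ 2 + dist x q ^ 2 := by
        gcongr
        exact dist_triangle_right y p m
    _ ≤ dist y m ^ 2 / t + dist p m ^ 2 / (1 - t) + dist x q ^ 2 := by
        gcongr
        exact add_sq_le_sq_div_add_sq_div ht _ _
    _ ≤ ((1 - t) * dist y x ^ 2 + t * dist y q ^ 2 - t * (1 - t) * dist x q ^ 2) / t +
        ((1 - t) * dist p x ^ 2 + t * dist p q ^ 2 - t * (1 - t) * dist x q ^ 2) / (1 - t) +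
          dist x q ^ 2 := by gcongr
    _ = _ := by
        rw [dist_comm y x, dist_comm p x]
        field_simp
        ring

/-- Reshetnyak's quadruple comparison. -/
theorem sq_dist_add_sq_dist_le (hM : IsGlobalNPC M) (x y p q : M) :
    dist y p ^ 2 + dist x q ^ 2 ≤
      dist x p ^ 2 + dist y q ^ 2 + 2 * dist x y * dist p q := by
  rcases eq_or_ne x y with rfl | hxy
  · simp
  rcases eq_or_ne p q with rfl | hpq
  · simp [add_comm]
  have hxy := dist_pos.2 hxy
  have hpq := dist_pos.2 hpq
  have h := hM.sq_dist_add_sq_dist_le_weighted x y p q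
    (t := dist x y / (dist x y + dist p q))
    ⟨by positivity, by rw [div_lt_one (by positivity)]; linarith⟩
  have hcompl : 1 - dist x y / (dist x y + dist p q) = dist p q / (dist x y + dist p q) := by
    field_simp; ring
  rw [hcompl] at h
  convert h using 2
  field_simp
  ring

variable [Nonempty M]

lemma isMinimalGeodesic_geodesicPoint (hM : IsGlobalNPC M) (x y : M) :
    IsMinimalGeodesic x y (geodesicPoint x y) :=
  Classical.epsilon_spec (hM.exists_isMinimalGeodesic x y)

lemma isNPCPoint_geodesicPoint (hM : IsGlobalNPC M) (x y : M) {t : ℝ} (ht : t ∈ Icc (0 : ℝ) 1) :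
    IsNPCPoint x y t (geodesicPoint x y t) :=
  (hM.isMinimalGeodesic_geodesicPoint x y).isNPCPoint hM ht

theorem isMinimalGeodesic_iff (hM : IsGlobalNPC M) (x y : M) (γ : ℝ → M) :
    IsMinimalGeodesic x y γ ↔ EqOn γ (geodesicPoint x y) (Icc 0 1) := by
  refine ⟨fun h t ht => (h.isNPCPoint hM ht).unique ht (hM.isNPCPoint_geodesicPoint x y ht),
    fun h => ?_⟩
  obtain ⟨h0, h1, hdist⟩ := hM.isMinimalGeodesic_geodesicPoint x y
  refine ⟨?_, ?_, fun s hs t ht => ?_⟩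
  · rw [h (by simp), h0]
  · rw [h (by simp), h1]
  · rw [h hs, h ht, hdist s hs t ht]

variable {t : ℝ}

lemma geodesicPoint_self (hM : IsGlobalNPC M) (x : M) (ht : t ∈ Icc (0 : ℝ) 1) :
    geodesicPoint x x t = x := by
  simpa using (hM.isNPCPoint_geodesicPoint x x ht).dist_left_le ht

lemma geodesicPoint_symm (hM : IsGlobalNPC M) (x y : M) (ht : t ∈ Icc (0 : ℝ) 1) :
    geodesicPoint x y t = geodesicPoint y x (1 - t) := by
  have ht' : 1 - t ∈ Icc (0 : ℝ) 1 := ⟨sub_nonneg.2 ht.2, sub_le_self _ ht.1⟩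
  exact (hM.isNPCPoint_geodesicPoint x y ht).symm.unique ht' (hM.isNPCPoint_geodesicPoint y x ht')

lemma dist_geodesicPoint_geodesicPoint_right_le (hM : IsGlobalNPC M) (x y y' : M)
    (ht : t ∈ Icc (0 : ℝ) 1) :
    dist (geodesicPoint x y t) (geodesicPoint x y' t) ≤ t * dist y y' := by
  have hm := hM.isNPCPoint_geodesicPoint x y ht
  have hm_m' := hM.isNPCPoint_geodesicPoint x y' ht (geodesicPoint x y t)
  have hm_y' := mul_le_mul_of_nonneg_left (hm y') ht.1
  have hm_x := mul_le_mul_of_nonneg_left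
    (pow_le_pow_left₀ dist_nonneg (hm.dist_left_le ht) 2) (sub_nonneg.2 ht.2)
  rw [dist_comm y' x, dist_comm y' y, dist_comm y'] at hm_y'
  refine abs_le_of_sq_le_sq' ?_ (mul_nonneg ht.1 dist_nonneg) |>.2
  linarith

theorem dist_geodesicPoint_geodesicPoint_le (hM : IsGlobalNPC M) (x y x' y' : M)
    (ht : t ∈ Icc (0 : ℝ) 1) :
    dist (geodesicPoint x y t) (geodesicPoint x' y' t) ≤
      (1 - t) * dist x x' + t * dist y y' := by
  have hleft := hM.dist_geodesicPoint_geodesicPoint_right_le y' x x' (t := 1 - t)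
    ⟨sub_nonneg.2 ht.2, sub_le_self _ ht.1⟩
  rw [← hM.geodesicPoint_symm x y' ht, ← hM.geodesicPoint_symm x' y' ht] at hleft
  have hright := hM.dist_geodesicPoint_geodesicPoint_right_le x y y' ht
  linarith [dist_triangle (geodesicPoint x y t) (geodesicPoint x y' t) (geodesicPoint x' y' t)]

lemma edist_geodesicPoint_geodesicPoint_le (hM : IsGlobalNPC M) (x y x' y' : M)
    (ht : t ∈ Icc (0 : ℝ) 1) :
    edist (geodesicPoint x y t) (geodesicPoint x' y' t) ≤
      ENNReal.ofReal (1 - t) * edist x x' + ENNReal.ofReal t * edist y y' := by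
  have ht1 := sub_nonneg.2 ht.2
  simp only [edist_dist]
  rw [← ENNReal.ofReal_mul ht1, ← ENNReal.ofReal_mul ht.1,
    ← ENNReal.ofReal_add (by positivity) (mul_nonneg ht.1 dist_nonneg)]
  exact ENNReal.ofReal_le_ofReal (hM.dist_geodesicPoint_geodesicPoint_le x y x' y' ht)

lemma lipschitzWith_geodesicPoint (hM : IsGlobalNPC M) (x : M) (ht : t ∈ Icc (0 : ℝ) 1) :
    LipschitzWith 1 fun a => geodesicPoint x a t :=
  LipschitzWith.of_dist_le_mul fun a b =>
    (hM.dist_geodesicPoint_geodesicPoint_right_le x a b ht).trans <| by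
      simpa using mul_le_of_le_one_left dist_nonneg ht.2

end IsGlobalNPC

end Geometry

/-! ### Measures and functions with finite first moment -/

section FirstMoment

variable {M : Type*} [MetricSpace M] {Ω : Type*} [MeasurableSpace Ω] {P : Measure Ω}
  {φ ψ : Ω → M}

lemma exists_subset_isSeparated_isCover (S : Set M) (ε : NNReal) :
    ∃ N ⊆ S, Metric.IsSeparated ε N ∧ Metric.IsCover ε S N := by
  obtain ⟨N, hN⟩ := zorn_subset {N | N ⊆ S ∧ Metric.IsSeparated ε N} fun c hc hchain =>
    ⟨⋃₀ c, ⟨sUnion_subset fun s hs => (hc hs).1,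
      (pairwise_sUnion hchain.directedOn).2 fun s hs => (hc hs).2⟩,
      fun s hs => subset_sUnion_of_mem hs⟩
  exact ⟨N, hN.prop.1, hN.prop.2, .of_maximal_isSeparated hN⟩

lemma distL1_comm (P : Measure Ω) (φ ψ : Ω → M) : distL1 P φ ψ = distL1 P ψ φ := by
  simp only [distL1, edist_comm]

lemma distL1_triangle {χ : Ω → M} (hφ : AEStronglyMeasurable φ P)
    (hψ : AEStronglyMeasurable ψ P) : distL1 P φ χ ≤ distL1 P φ ψ + distL1 P ψ χ := by
  unfold distL1
  rw [← lintegral_add_left' (hφ.edist hψ)]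
  exact lintegral_mono fun ω => edist_triangle _ _ _

namespace MemL1

lemma lintegral_edist_lt_top [IsFiniteMeasure P] (hφ : MemL1 P φ) (z : M) :
    ∫⁻ ω, edist z (φ ω) ∂P < ∞ := by
  obtain ⟨-, x, hx⟩ := hφ
  calc ∫⁻ ω, edist z (φ ω) ∂P ≤ ∫⁻ ω, (edist z x + edist x (φ ω)) ∂P :=
        lintegral_mono fun ω => edist_triangle _ _ _
    _ = edist z x * P univ + ∫⁻ ω, edist x (φ ω) ∂P := by
        rw [lintegral_add_left measurable_const, lintegral_const]
    _ < ∞ := ENNReal.add_lt_top.2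
        ⟨ENNReal.mul_lt_top (edist_lt_top _ _) (measure_lt_top _ _), hx⟩

lemma lipschitzWith_comp {N : Type*} [MetricSpace N] {f : M → N} {K : NNReal}
    (hφ : MemL1 P φ) (hf : LipschitzWith K f) : MemL1 P (f ∘ φ) := by
  obtain ⟨hφm, x, hx⟩ := hφ
  refine ⟨hf.continuous.comp_aestronglyMeasurable hφm, f x, ?_⟩
  refine (lintegral_mono fun ω => hf x (φ ω)).trans_lt ?_
  rw [lintegral_const_mul' _ _ ENNReal.coe_ne_top]
  exact ENNReal.mul_lt_top ENNReal.coe_lt_top hx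

end MemL1

lemma memL1_of_edist_le [IsFiniteMeasure P] (hφ : AEStronglyMeasurable φ P) {x : M} {C : ℝ≥0∞}
    (hC : C ≠ ∞) (hφC : ∀ ω, edist x (φ ω) ≤ C) : MemL1 P φ := by
  refine ⟨hφ, x, (lintegral_mono hφC).trans_lt ?_⟩
  rw [lintegral_const]
  exact ENNReal.mul_lt_top hC.lt_top (measure_lt_top _ _)

lemma edist_simpleFunc_le (ψ : SimpleFunc Ω M) (x : M) (ω : Ω) :
    edist x (ψ ω) ≤ ∑ y ∈ ψ.range, edist x y :=
  Finset.single_le_sum (f := fun y => edist x y) (fun _ _ => zero_le) (ψ.mem_range_self ω)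

lemma memL1_simpleFunc [IsFiniteMeasure P] (x : M) (ψ : SimpleFunc Ω M) : MemL1 P ψ :=
  memL1_of_edist_le ψ.stronglyMeasurable.aestronglyMeasurable
    (ENNReal.sum_ne_top.2 fun _ _ => edist_ne_top _ _) (edist_simpleFunc_le ψ x)

variable [MeasurableSpace M]

lemma countable_of_isSeparated_of_subset_support [OpensMeasurableSpace M] {μ : Measure M}
    [SFinite μ] {N : Set M} {ε : NNReal} (hε : 0 < ε) (hN : Metric.IsSeparated ε N)
    (hNμ : N ⊆ μ.support) : N.Countable := by
  have hdisj : Pairwise (Function.onFun Disjoint fun x : N => Metric.ball (x : M) (ε / 2)) := by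
    intro x y hxy
    refine Metric.ball_disjoint_ball ?_
    have hdist : (ε : ℝ≥0∞) < edist (x : M) y := hN x.2 y.2 (Subtype.coe_ne_coe.2 hxy)
    rw [edist_nndist, ENNReal.coe_lt_coe] at hdist
    rw [add_halves]
    exact_mod_cast hdist.le
  have hpos := Measure.countable_meas_pos_of_disjoint_iUnion (μ := μ)
    (fun x : N => Metric.isOpen_ball.measurableSet) hdisj
  refine countable_coe_iff.1 (countable_univ_iff.1 (hpos.mono fun x _ => ?_))
  exact (Measure.mem_support_iff_forall _).1 (hNμ x.2) _ (Metric.ball_mem_nhds _ (by positivity))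

lemma isSeparable_support [OpensMeasurableSpace M] (μ : Measure M) [SFinite μ] :
    TopologicalSpace.IsSeparable μ.support := by
  obtain ⟨N, -, hN, hdense⟩ := EMetric.subset_countable_closure_of_almost_dense_set μ.support
    fun ε hε => by
      obtain ⟨δ, hδ, hδε⟩ := ENNReal.lt_iff_exists_nnreal_btwn.1 hε
      obtain ⟨N, hNμ, hN, hcover⟩ := exists_subset_isSeparated_isCover μ.support δ
      refine ⟨N, countable_of_isSeparated_of_subset_support (ENNReal.coe_pos.1 hδ) hN hNμ, ?_⟩
      exact (Metric.isCover_iff_subset_iUnion_closedEBall.1 hcover).trans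
        (iUnion₂_mono fun x _ => Metric.closedEBall_subset_closedEBall hδε.le)
  exact ⟨N, hN, hdense⟩

lemma measure_compl_support_eq_zero_of_isSeparable {μ : Measure M} {S : Set M}
    (hS : TopologicalSpace.IsSeparable S) (hμS : μ Sᶜ = 0) : μ (μ.support)ᶜ = 0 := by
  have : TopologicalSpace.SeparableSpace S := hS.separableSpace
  have : SecondCountableTopology S := UniformSpace.secondCountable_of_separable S
  have hlindelof : IsLindelof (S ∩ μ.supportᶜ) := by
    rw [← Subtype.image_preimage_coe]
    exact (HereditarilyLindelofSpace.isLindelof _).image continuous_subtype_val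
  have hnull : (S ∩ μ.supportᶜ)ᶜ ∈ ae μ := by
    refine hlindelof.compl_mem_sets_of_nhdsWithin fun s hs => ?_
    obtain ⟨U, hU, hU0⟩ := Measure.notMem_support_iff_exists.mp hs.2
    exact ⟨U, mem_nhdsWithin_of_mem_nhds hU, by rwa [compl_mem_ae_iff]⟩
  rw [compl_mem_ae_iff] at hnull
  refine measure_mono_null (fun a ha => ?_) (measure_union_null hμS hnull)
  by_cases haS : a ∈ S
  exacts [.inr ⟨haS, ha⟩, .inl haS]

theorem mem_P1_iff [BorelSpace M] {μ : Measure M} :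
    μ ∈ P1 M ↔ IsProbabilityMeasure μ ∧ MemL1 μ id := by
  have hsep : IsProbabilityMeasure μ → (μ (μ.support)ᶜ = 0 ↔ AEStronglyMeasurable id μ) := by
    intro _
    rw [aestronglyMeasurable_iff_aemeasurable_separable]
    exact ⟨fun h => ⟨aemeasurable_id, _, isSeparable_support μ, h⟩,
      fun ⟨_, S, hS, hμS⟩ => measure_compl_support_eq_zero_of_isSeparable hS hμS⟩
  exact and_congr_right fun hμ => and_congr_left fun _ => hsep hμ

lemma MemL1.map_mem_P1 [BorelSpace M] [IsProbabilityMeasure P] (hφ : MemL1 P φ) :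
    P.map φ ∈ P1 M := by
  obtain ⟨hφm, S, hS, hφS⟩ := aestronglyMeasurable_iff_aemeasurable_separable.1 hφ.1
  obtain ⟨x, hx⟩ := hφ.2
  refine ⟨Measure.isProbabilityMeasure_map hφm, ?_, x, (lintegral_map_le _ _).trans_lt hx⟩
  refine measure_compl_support_eq_zero_of_isSeparable hS.closure ?_
  rw [Measure.map_apply_of_aemeasurable hφm isClosed_closure.measurableSet.compl]
  exact measure_mono_null (compl_subset_compl.2 (preimage_mono subset_closure)) hφS

lemma dirac_mem_P1 [BorelSpace M] (x : M) : Measure.dirac x ∈ P1 M :=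
  mem_P1_iff.2 ⟨inferInstance, aestronglyMeasurable_dirac, x, by simp⟩

/-- Simple functions are dense in `L¹(Ω;M)`: on the separable range of a representative of `φ`
they approximate it pointwise, dominated by the distance to a base point. -/
lemma MemL1.exists_simpleFunc_distL1_le [BorelSpace M] (hφ : MemL1 P φ) {ε : ℝ≥0∞}
    (hε : 0 < ε) : ∃ ψ : SimpleFunc Ω M, distL1 P φ ψ ≤ ε := by
  obtain ⟨hφm, x, hx⟩ := hφ
  set φ' := hφm.mk φ
  have hφ' : StronglyMeasurable φ' := hφm.stronglyMeasurable_mk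
  have hsep : TopologicalSpace.IsSeparable (insert x (range φ')) :=
    (countable_singleton x).isSeparable.union hφ'.isSeparable_range
  have := hsep.separableSpace
  set ψ := SimpleFunc.approxOn φ' hφ'.measurable (insert x (range φ')) x (mem_insert _ _)
  have hx' : ∫⁻ ω, edist x (φ' ω) ∂P ≠ ∞ :=
    ne_of_eq_of_ne (lintegral_congr_ae (hφm.ae_eq_mk.fun_comp (edist x))).symm hx.ne
  have hψ : Tendsto (fun n => distL1 P φ' (ψ n)) atTop (𝓝 (∫⁻ _, 0 ∂P)) := by
    refine tendsto_lintegral_of_dominated_convergence (fun ω => edist x (φ' ω)) (fun n => ?_)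
      (fun n => .of_forall fun ω => ?_) hx' (.of_forall fun ω => ?_)
    · exact (hφ'.edist (ψ n).stronglyMeasurable).measurable
    · exact (edist_comm _ _).trans_le (SimpleFunc.edist_approxOn_le _ _ ω n)
    · have hlim : Tendsto (fun n => ψ n ω) atTop (𝓝 (φ' ω)) := SimpleFunc.tendsto_approxOn _ _
        (subset_closure (mem_insert_of_mem _ (mem_range_self ω)))
      simpa only [edist_comm] using tendsto_iff_edist_tendsto_0.1 hlim
  rw [lintegral_zero] at hψ
  obtain ⟨n, hn⟩ := (ENNReal.tendsto_nhds_zero.1 hψ ε hε).exists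
  exact ⟨ψ n, (lintegral_congr_ae (hφm.ae_eq_mk.mono fun ω h => by rw [h])).trans_le hn⟩

namespace P1

variable [BorelSpace M] {μ : Measure M}

lemma memL1 (hμ : μ ∈ P1 M) : MemL1 μ id := (mem_P1_iff.1 hμ).2

lemma map_mem (hμ : μ ∈ P1 M) {f : M → M} {K : NNReal} (hf : LipschitzWith K f) :
    μ.map f ∈ P1 M :=
  have := hμ.1
  ((P1.memL1 hμ).lipschitzWith_comp hf).map_mem_P1

lemma integrable_dist (hμ : μ ∈ P1 M) (z : M) : Integrable (fun y => dist z y) μ := by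
  have := hμ.1
  refine ⟨(continuous_const.dist continuous_id).measurable.aestronglyMeasurable, ?_⟩
  rw [hasFiniteIntegral_iff_ofReal (.of_forall fun _ => dist_nonneg)]
  simpa only [edist_dist, id_eq] using (P1.memL1 hμ).lintegral_edist_lt_top z

end P1

end FirstMoment

/-! ### The Wasserstein distance -/

section Wasserstein

lemma isFiniteMeasure_sum_smul_dirac {α : Type*} [MeasurableSpace α] {F : Finset α}
    {w : α → ℝ≥0∞} (hw : ∀ x ∈ F, w x ≠ ∞) :
    IsFiniteMeasure (∑ x ∈ F, w x • Measure.dirac x) := by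
  refine ⟨?_⟩
  simpa [Measure.coe_finsetSum, Finset.sum_apply, lt_top_iff_ne_top] using hw

variable {M : Type*} [MetricSpace M] [MeasurableSpace M]

lemma wasserstein1_map_map_le {Ω : Type*} [MeasurableSpace Ω] {P : Measure Ω} {f g : Ω → M}
    (hf : AEMeasurable f P) (hg : AEMeasurable g P) :
    wasserstein1 (P.map f) (P.map g) ≤ distL1 P f g :=
  (iInf₂_le (P.map fun ω => (f ω, g ω))
    ⟨Measure.fst_map_prodMk₀ hg, Measure.snd_map_prodMk₀ hf⟩).trans (lintegral_map_le _ _)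

lemma wasserstein1_dirac_right_le (μ : Measure M) [IsProbabilityMeasure μ] (x : M) :
    wasserstein1 μ (Measure.dirac x) ≤ ∫⁻ y, edist y x ∂μ := by
  have h := wasserstein1_map_map_le (P := μ) aemeasurable_id (aemeasurable_const (b := x))
  rwa [Measure.map_id, Measure.map_const, measure_univ, one_smul] at h

lemma wasserstein1_add_left_le [OpensMeasurableSpace M] (α μ ν : Measure M) :
    wasserstein1 (α + μ) (α + ν) ≤ wasserstein1 μ ν := by
  refine le_iInf₂ fun π hπ => ?_
  have hdiag : Measurable fun x : M => (x, x) := measurable_id.prodMk measurable_id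
  have hfst : (α.map fun x => (x, x)).map Prod.fst = α :=
    (Measure.map_map measurable_fst hdiag).trans Measure.map_id
  have hsnd : (α.map fun x => (x, x)).map Prod.snd = α :=
    (Measure.map_map measurable_snd hdiag).trans Measure.map_id
  refine (iInf₂_le (α.map (fun x => (x, x)) + π) ⟨?_, ?_⟩).trans ?_
  · have hzero : ∫⁻ p, edist p.1 p.2 ∂(α.map fun x => (x, x)) ≤ 0 :=
      (lintegral_map_le _ _).trans (by simp)
    rw [lintegral_add_measure, nonpos_iff_eq_zero.1 hzero, zero_add]
  · rw [Measure.map_add _ _ measurable_fst, hfst, hπ.1]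
  · rw [Measure.map_add _ _ measurable_snd, hsnd, hπ.2]

/-- The normalized product measure is a coupling. -/
lemma wasserstein1_le_lintegral_add_lintegral [OpensMeasurableSpace M] (μ ν : Measure M)
    [IsFiniteMeasure μ] [IsFiniteMeasure ν] (h : μ univ = ν univ) (z : M) :
    wasserstein1 μ ν ≤ ∫⁻ x, edist z x ∂μ + ∫⁻ x, edist z x ∂ν := by
  have hnormalize (ρ : Measure M) [IsFiniteMeasure ρ] : (ρ univ)⁻¹ • ρ univ • ρ = ρ := by
    rcases eq_or_ne ρ 0 with rfl | hρ
    · simp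
    · rw [smul_smul, ENNReal.inv_mul_cancel (by simpa using hρ) (measure_ne_top _ _), one_smul]
  set π : Measure (M × M) := (μ univ)⁻¹ • μ.prod ν with hπ
  have hfst : π.map Prod.fst = μ := by
    rw [hπ, Measure.map_smul, Measure.map_fst_prod, ← h, hnormalize]
  have hsnd : π.map Prod.snd = ν := by
    rw [hπ, Measure.map_smul, Measure.map_snd_prod, h, hnormalize]
  have hz : Measurable fun x : M => edist z x := measurable_edist_right
  calc wasserstein1 μ ν ≤ ∫⁻ p, edist p.1 p.2 ∂π := iInf₂_le π ⟨hfst, hsnd⟩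
    _ ≤ ∫⁻ p, (edist z p.1 + edist z p.2) ∂π :=
        lintegral_mono fun p => edist_triangle_left _ _ _
    _ = ∫⁻ p, edist z p.1 ∂π + ∫⁻ p, edist z p.2 ∂π :=
        lintegral_add_left (hz.comp measurable_fst) _
    _ = _ := by
        rw [← lintegral_map hz measurable_fst, ← lintegral_map hz measurable_snd, hfst, hsnd]

lemma wasserstein1_sum_dirac_le [OpensMeasurableSpace M] {F : Finset M} {p q : M → ℝ≥0∞}
    (hp : ∀ x ∈ F, p x ≠ ∞) (hq : ∀ x ∈ F, q x ≠ ∞) (h : ∑ x ∈ F, p x = ∑ x ∈ F, q x) (z : M) :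
    wasserstein1 (∑ x ∈ F, p x • Measure.dirac x) (∑ x ∈ F, q x • Measure.dirac x) ≤
      ∑ x ∈ F, (p x - q x) * edist z x + ∑ x ∈ F, (q x - p x) * edist z x := by
  have hmin : ∀ x ∈ F, min (p x) (q x) ≠ ∞ := fun x hx =>
    ((min_le_left _ _).trans_lt (hp x hx).lt_top).ne
  have hp_split (x : M) : min (p x) (q x) + (p x - q x) = p x := by
    rw [add_comm, tsub_add_min]
  have hq_split (x : M) : min (p x) (q x) + (q x - p x) = q x := by
    rw [add_comm, min_comm, tsub_add_min]
  have hmass : ∑ x ∈ F, (p x - q x) = ∑ x ∈ F, (q x - p x) := by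
    refine (ENNReal.add_right_inj (ENNReal.sum_ne_top.2 hmin)).1 ?_
    simpa only [← Finset.sum_add_distrib, hp_split, hq_split] using h
  have := isFiniteMeasure_sum_smul_dirac fun x hx => ENNReal.sub_ne_top (b := q x) (hp x hx)
  have := isFiniteMeasure_sum_smul_dirac fun x hx => ENNReal.sub_ne_top (b := p x) (hq x hx)
  calc wasserstein1 (∑ x ∈ F, p x • Measure.dirac x) (∑ x ∈ F, q x • Measure.dirac x)
      = wasserstein1
          (∑ x ∈ F, min (p x) (q x) • Measure.dirac x + ∑ x ∈ F, (p x - q x) • Measure.dirac x)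
          (∑ x ∈ F, min (p x) (q x) • Measure.dirac x +
            ∑ x ∈ F, (q x - p x) • Measure.dirac x) := by
        simp only [← Finset.sum_add_distrib, ← add_smul, hp_split, hq_split]
    _ ≤ wasserstein1 (∑ x ∈ F, (p x - q x) • Measure.dirac x)
          (∑ x ∈ F, (q x - p x) • Measure.dirac x) := wasserstein1_add_left_le _ _ _
    _ ≤ _ := wasserstein1_le_lintegral_add_lintegral _ _
        (by simpa [Measure.coe_finsetSum, Finset.sum_apply] using hmass) z
    _ = _ := by simp [lintegral_smul_measure]

end Wasserstein

/-! ### The canonical barycenter -/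

lemma ofReal_integral_le_lintegral_ofReal {α : Type*} [MeasurableSpace α] {μ : Measure α}
    {f : α → ℝ} (hf : Integrable f μ) :
    ENNReal.ofReal (∫ x, f x ∂μ) ≤ ∫⁻ x, ENNReal.ofReal (f x) ∂μ :=
  calc ENNReal.ofReal (∫ x, f x ∂μ) ≤ ENNReal.ofReal (∫ x, max (f x) 0 ∂μ) :=
        ENNReal.ofReal_le_ofReal (integral_mono hf hf.pos_part fun x => le_max_left _ _)
    _ = ∫⁻ x, ENNReal.ofReal (max (f x) 0) ∂μ :=
        ofReal_integral_eq_lintegral_ofReal hf.pos_part (.of_forall fun x => le_max_right _ _)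
    _ = ∫⁻ x, ENNReal.ofReal (f x) ∂μ := by
        simp only [ENNReal.ofReal_max, ENNReal.ofReal_zero, zero_le, sup_of_le_left]

section Barycenter

variable {M : Type*} [MetricSpace M]

/-- Uniform convexity makes minimizing sequences Cauchy. -/
lemma exists_forall_le_of_midpoint_le [CompleteSpace M] [Nonempty M] {f : M → ℝ}
    (hf : LowerSemicontinuous f) (hbdd : BddBelow (range f))
    (hmid : ∀ z w, ∃ m, f m ≤ f z / 2 + f w / 2 - dist z w ^ 2 / 4) : ∃ b, ∀ w, f b ≤ f w := by
  obtain ⟨u, hu_anti, hu, hu_mem⟩ := exists_seq_tendsto_sInf (range_nonempty f) hbdd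
  choose z hz using hu_mem
  set I := sInf (range f)
  have hI (w : M) : I ≤ f w := csInf_le hbdd (mem_range_self w)
  have hdist (n m N : ℕ) (hn : N ≤ n) (hm : N ≤ m) : dist (z n) (z m) ≤ √(4 * (u N - I)) := by
    obtain ⟨p, hp⟩ := hmid (z n) (z m)
    rw [hz, hz] at hp
    refine Real.le_sqrt_of_sq_le ?_
    linarith [hI p, hu_anti hn, hu_anti hm]
  have hbound : Tendsto (fun N => √(4 * (u N - I))) atTop (𝓝 0) := by
    simpa using ((hu.sub_const I).const_mul 4).sqrt
  obtain ⟨b, hb⟩ := cauchySeq_tendsto_of_complete (cauchySeq_of_le_tendsto_0 _ hdist hbound)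
  refine ⟨b, fun w => le_trans (le_of_forall_lt_imp_le_of_dense fun a ha => ?_) (hI w)⟩
  refine ge_of_tendsto hu ((hb.eventually (hf b a ha)).mono fun n hn => ?_)
  exact (hn.trans_eq (hz n)).le

lemma abs_sq_dist_sub_sq_dist_le (y z x : M) :
    |dist z x ^ 2 - dist y x ^ 2| ≤ dist z y * (dist z x + dist y x) := by
  rw [sq_sub_sq, mul_comm, abs_mul, abs_of_nonneg (add_nonneg dist_nonneg dist_nonneg)]
  exact mul_le_mul_of_nonneg_right (abs_dist_sub_le z y x) (by positivity)

variable [MeasurableSpace M]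

/-- The functional `z ↦ ∫ [d(z,x)² - d(y,x)²] dμ(x)` minimized by the canonical barycenter. -/
noncomputable def sqDistGap (μ : Measure M) (y z : M) : ℝ :=
  ∫ x, (dist z x ^ 2 - dist y x ^ 2) ∂μ

lemma sqDistGap_self (μ : Measure M) (y : M) : sqDistGap μ y y = 0 := by
  simp [sqDistGap]

variable [BorelSpace M] {μ ν : Measure M}

lemma measurable_sq_dist_sub (y z : M) : Measurable fun x => dist z x ^ 2 - dist y x ^ 2 :=
  (by fun_prop : Continuous fun x => dist z x ^ 2 - dist y x ^ 2).measurable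

lemma integrable_sq_dist_sub (hμ : μ ∈ P1 M) (y z : M) :
    Integrable (fun x => dist z x ^ 2 - dist y x ^ 2) μ :=
  (((P1.integrable_dist hμ z).add (P1.integrable_dist hμ y)).const_mul (dist z y)).mono'
    (measurable_sq_dist_sub y z).aestronglyMeasurable
    (.of_forall fun x => abs_sq_dist_sub_sq_dist_le y z x)

lemma sqDistGap_map {α : Type*} [MeasurableSpace α] {π : Measure α} {f : α → M}
    (hf : Measurable f) (y z : M) :
    sqDistGap (π.map f) y z = ∫ p, (dist z (f p) ^ 2 - dist y (f p) ^ 2) ∂π :=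
  integral_map hf.aemeasurable (measurable_sq_dist_sub y z).aestronglyMeasurable

lemma sqDistGap_add (hμ : μ ∈ P1 M) (y z w : M) :
    sqDistGap μ y z + sqDistGap μ z w = sqDistGap μ y w := by
  unfold sqDistGap
  rw [← integral_add (integrable_sq_dist_sub hμ y z) (integrable_sq_dist_sub hμ z w)]
  exact integral_congr_ae (.of_forall fun x => by ring)

lemma sqDistGap_le (hμ : μ ∈ P1 M) (y z : M) :
    sqDistGap μ y z ≤ dist z y * (dist z y + 2 * ∫ x, dist z x ∂μ) := by
  have := hμ.1
  have hz := (P1.integrable_dist hμ z).const_mul 2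
  calc sqDistGap μ y z ≤ ∫ x, dist z y * (dist z y + 2 * dist z x) ∂μ := by
        refine integral_mono (integrable_sq_dist_sub hμ y z)
          (((integrable_const _).add hz).const_mul _) fun x => ?_
        refine (le_abs_self _).trans ((abs_sq_dist_sub_sq_dist_le y z x).trans ?_)
        exact mul_le_mul_of_nonneg_left (by linarith [dist_triangle_left y x z]) dist_nonneg
    _ = _ := by
        rw [integral_const_mul, integral_add (integrable_const _) hz, integral_const_mul]
        simp only [integral_const, probReal_univ, smul_eq_mul, one_mul]

lemma le_sqDistGap (hμ : μ ∈ P1 M) (y z : M) :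
    -(∫ x, dist y x ∂μ) ^ 2 ≤ sqDistGap μ y z := by
  have := hμ.1
  have hy := (P1.integrable_dist hμ y).const_mul (2 * dist z y)
  have hpointwise (x : M) : dist z y ^ 2 - 2 * dist z y * dist y x ≤
      dist z x ^ 2 - dist y x ^ 2 := by
    have habs : |dist z y - dist x y| ≤ |dist z x| :=
      (abs_dist_sub_le z x y).trans (le_abs_self _)
    rw [dist_comm x y] at habs
    linarith [sq_le_sq.2 habs]
  calc -(∫ x, dist y x ∂μ) ^ 2 ≤ dist z y ^ 2 - 2 * dist z y * ∫ x, dist y x ∂μ := by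
        linarith [sq_nonneg (dist z y - ∫ x, dist y x ∂μ)]
    _ = ∫ x, (dist z y ^ 2 - 2 * dist z y * dist y x) ∂μ := by
        rw [integral_sub (integrable_const _) hy, integral_const_mul]
        simp only [integral_const, probReal_univ, smul_eq_mul, one_mul]
    _ ≤ sqDistGap μ y z :=
        integral_mono ((integrable_const _).sub hy) (integrable_sq_dist_sub hμ y z) hpointwise

lemma lowerSemicontinuous_sqDistGap (hμ : μ ∈ P1 M) (y : M) :
    LowerSemicontinuous (sqDistGap μ y) := by
  intro z a ha
  set bound : M → ℝ := fun w => sqDistGap μ y z - dist z w * (dist z w + 2 * ∫ x, dist z x ∂μ)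
  have hcont : Continuous bound := by fun_prop
  have hz : a < bound z := by simpa [bound] using ha
  filter_upwards [hcont.continuousAt.eventually_const_lt hz] with w hw
  linarith [sqDistGap_add hμ y w z, sqDistGap_le hμ w z]

lemma IsNPCPoint.sqDistGap_le (hμ : μ ∈ P1 M) (y : M) {z w m : M} {t : ℝ}
    (hm : IsNPCPoint z w t m) :
    sqDistGap μ y m ≤ (1 - t) * sqDistGap μ y z + t * sqDistGap μ y w
      - t * (1 - t) * dist z w ^ 2 := by
  have := hμ.1
  have hz := (integrable_sq_dist_sub hμ y z).const_mul (1 - t)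
  have hw := (integrable_sq_dist_sub hμ y w).const_mul t
  calc sqDistGap μ y m ≤ ∫ x, ((1 - t) * (dist z x ^ 2 - dist y x ^ 2) +
        t * (dist w x ^ 2 - dist y x ^ 2) - t * (1 - t) * dist z w ^ 2) ∂μ := by
        refine integral_mono (integrable_sq_dist_sub hμ y m)
          ((hz.add hw).sub (integrable_const _)) fun x => ?_
        have hmx := hm x
        simp only [dist_comm x] at hmx
        linarith
    _ = _ := by
        rw [integral_sub (by exact hz.add hw) (integrable_const _), integral_add hz hw,
          integral_const_mul, integral_const_mul]
        simp only [integral_const, probReal_univ, smul_eq_mul, one_mul, sqDistGap]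

namespace IsGlobalNPC

lemma exists_isCanonicalBarycenter [Nonempty M] (hM : IsGlobalNPC M) (hμ : μ ∈ P1 M) :
    ∃ z, IsCanonicalBarycenter μ z := by
  have := hM.complete
  obtain ⟨y⟩ := ‹Nonempty M›
  have hmid (z w : M) : ∃ m, sqDistGap μ y m ≤
      sqDistGap μ y z / 2 + sqDistGap μ y w / 2 - dist z w ^ 2 / 4 := by
    obtain ⟨m, hm⟩ := hM.exists_isNPCPoint z w (t := 1 / 2) ⟨by norm_num, by norm_num⟩
    exact ⟨m, by linarith [hm.sqDistGap_le hμ y]⟩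
  obtain ⟨b, hb⟩ := exists_forall_le_of_midpoint_le (lowerSemicontinuous_sqDistGap hμ y)
    ⟨_, forall_mem_range.2 fun z => le_sqDistGap hμ y z⟩ hmid
  refine ⟨b, fun y' w => ?_⟩
  change sqDistGap μ y' b ≤ sqDistGap μ y' w
  linarith [sqDistGap_add hμ y' y b, sqDistGap_add hμ y' y w, hb w]

/-- The variance inequality. -/
lemma sq_dist_le_sqDistGap (hM : IsGlobalNPC M) (hμ : μ ∈ P1 M) {b : M}
    (hb : IsCanonicalBarycenter μ b) (w : M) : dist b w ^ 2 ≤ sqDistGap μ b w := by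
  have hle : ∀ t ∈ Ioo (0 : ℝ) 1, (1 - t) * dist b w ^ 2 ≤ sqDistGap μ b w := by
    intro t ht
    obtain ⟨m, hm⟩ := hM.exists_isNPCPoint b w ⟨ht.1.le, ht.2.le⟩
    have hbm : sqDistGap μ b b ≤ sqDistGap μ b m := hb b m
    have hconvex := hm.sqDistGap_le hμ b
    rw [sqDistGap_self] at hbm hconvex
    exact le_of_mul_le_mul_left (by linarith) ht.1
  have hlim : Tendsto (fun t : ℝ => (1 - t) * dist b w ^ 2) (𝓝[>] 0) (𝓝 (dist b w ^ 2)) :=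
    ((continuous_const.sub continuous_id).mul continuous_const).tendsto' _ _ (by simp)
      |>.mono_left nhdsWithin_le_nhds
  exact le_of_tendsto hlim (mem_of_superset (Ioo_mem_nhdsGT one_pos) hle)

lemma eq_of_isCanonicalBarycenter (hM : IsGlobalNPC M) (hμ : μ ∈ P1 M) {b b' : M}
    (hb : IsCanonicalBarycenter μ b) (hb' : IsCanonicalBarycenter μ b') : b = b' := by
  have hmin : sqDistGap μ b b' ≤ sqDistGap μ b b := hb' b b
  rw [sqDistGap_self] at hmin
  exact dist_eq_zero.1 (sq_nonpos_iff _ |>.1 ((hM.sq_dist_le_sqDistGap hμ hb b').trans hmin))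

lemma ofReal_sqDistGap_add_sqDistGap_le (hM : IsGlobalNPC M) {π : Measure (M × M)}
    (hπ₁ : π.map Prod.fst ∈ P1 M) (hπ₂ : π.map Prod.snd ∈ P1 M) (x y : M) :
    ENNReal.ofReal (sqDistGap (π.map Prod.fst) x y + sqDistGap (π.map Prod.snd) y x) ≤
      ENNReal.ofReal (2 * dist x y) * ∫⁻ p, edist p.1 p.2 ∂π := by
  have hfst : Integrable (fun p : M × M => dist y p.1 ^ 2 - dist x p.1 ^ 2) π :=
    (integrable_sq_dist_sub hπ₁ x y).comp_measurable measurable_fst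
  have hsnd : Integrable (fun p : M × M => dist x p.2 ^ 2 - dist y p.2 ^ 2) π :=
    (integrable_sq_dist_sub hπ₂ y x).comp_measurable measurable_snd
  rw [sqDistGap_map measurable_fst, sqDistGap_map measurable_snd, ← integral_add hfst hsnd,
    ← lintegral_const_mul' _ _ ENNReal.ofReal_ne_top]
  refine (ofReal_integral_le_lintegral_ofReal (hfst.add hsnd)).trans (lintegral_mono fun p => ?_)
  rw [edist_dist, ← ENNReal.ofReal_mul (by positivity)]
  refine ENNReal.ofReal_le_ofReal ?_
  rw [Pi.add_apply]
  linarith [hM.sq_dist_add_sq_dist_le x y p.1 p.2]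

variable [Nonempty M]

lemma isCanonicalBarycenter_canonicalBarycenter (hM : IsGlobalNPC M) (hμ : μ ∈ P1 M) :
    IsCanonicalBarycenter μ (canonicalBarycenter μ) :=
  Classical.epsilon_spec (hM.exists_isCanonicalBarycenter hμ)

theorem eq_canonicalBarycenter_iff (hM : IsGlobalNPC M) (hμ : μ ∈ P1 M) (z : M) :
    z = canonicalBarycenter μ ↔ IsCanonicalBarycenter μ z :=
  ⟨fun h => h ▸ hM.isCanonicalBarycenter_canonicalBarycenter hμ, fun h =>
    hM.eq_of_isCanonicalBarycenter hμ h (hM.isCanonicalBarycenter_canonicalBarycenter hμ)⟩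

lemma canonicalBarycenter_dirac (hM : IsGlobalNPC M) (x : M) :
    canonicalBarycenter (Measure.dirac x) = x := by
  refine ((hM.eq_canonicalBarycenter_iff (dirac_mem_P1 x) x).2 fun y w => ?_).symm
  rw [integral_dirac, integral_dirac, dist_self]
  linarith [sq_nonneg (dist w x)]

lemma edist_canonicalBarycenter_le (hM : IsGlobalNPC M) (hμ : μ ∈ P1 M) (hν : ν ∈ P1 M) :
    edist (canonicalBarycenter μ) (canonicalBarycenter ν) ≤ wasserstein1 μ ν := by
  set x := canonicalBarycenter μ
  set y := canonicalBarycenter ν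
  rcases eq_or_ne x y with hxy | hxy
  · simp [hxy]
  have hx : dist x y ^ 2 ≤ sqDistGap μ x y :=
    hM.sq_dist_le_sqDistGap hμ (hM.isCanonicalBarycenter_canonicalBarycenter hμ) y
  have hy : dist y x ^ 2 ≤ sqDistGap ν y x :=
    hM.sq_dist_le_sqDistGap hν (hM.isCanonicalBarycenter_canonicalBarycenter hν) x
  rw [dist_comm] at hy
  refine le_iInf₂ fun π hπ => ?_
  have hmul : ENNReal.ofReal (2 * dist x y) * edist x y ≤
      ENNReal.ofReal (2 * dist x y) * ∫⁻ p, edist p.1 p.2 ∂π := by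
    refine le_trans ?_
      (hM.ofReal_sqDistGap_add_sqDistGap_le (hπ.1.symm ▸ hμ) (hπ.2.symm ▸ hν) x y)
    rw [hπ.1, hπ.2]
    rw [edist_dist, ← ENNReal.ofReal_mul (by positivity)]
    exact ENNReal.ofReal_le_ofReal (by linarith)
  exact (ENNReal.mul_le_mul_iff_right (by simpa using hxy) ENNReal.ofReal_ne_top).1 hmul

theorem isContractiveBarycentricMap_canonicalBarycenter (hM : IsGlobalNPC M) :
    IsContractiveBarycentricMap (canonicalBarycenter : Measure M → M) :=
  ⟨hM.canonicalBarycenter_dirac, fun _ hμ _ hν => hM.edist_canonicalBarycenter_le hμ hν⟩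

end IsGlobalNPC

end Barycenter

/-! ### The semiflow on contractive barycentric maps -/

section Flow

variable {M : Type*} [MetricSpace M] [MeasurableSpace M] [BorelSpace M] {β : Measure M → M}
  {μ ν : Measure M}

namespace IsContractiveBarycentricMap

lemma edist_dirac_le (hβ : IsContractiveBarycentricMap β) (hμ : μ ∈ P1 M) (x : M) :
    edist (β μ) x ≤ ∫⁻ y, edist y x ∂μ := by
  have := hμ.1
  have hle := (hβ.2 μ hμ _ (dirac_mem_P1 x)).trans (wasserstein1_dirac_right_le μ x)
  rwa [hβ.1] at hle

lemma dist_dirac_le (hβ : IsContractiveBarycentricMap β) (hμ : μ ∈ P1 M) (x : M) :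
    dist (β μ) x ≤ ∫ y, dist x y ∂μ := by
  have hint := P1.integrable_dist hμ x
  refine (ENNReal.ofReal_le_ofReal_iff (integral_nonneg fun y => dist_nonneg)).1 ?_
  rw [ofReal_integral_eq_lintegral_ofReal hint (.of_forall fun y => dist_nonneg)]
  simpa only [edist_dist, dist_comm x] using hβ.edist_dirac_le hμ x

end IsContractiveBarycentricMap

variable [Nonempty M] {t : ℝ}

namespace IsGlobalNPC

lemma measurable_geodesicPoint (hM : IsGlobalNPC M) (x : M) (ht : t ∈ Icc (0 : ℝ) 1) :
    Measurable fun a => geodesicPoint x a t :=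
  (hM.lipschitzWith_geodesicPoint x ht).continuous.measurable

lemma geodesicPush_mem_P1 (hM : IsGlobalNPC M) (x : M) (ht : t ∈ Icc (0 : ℝ) 1)
    (hμ : μ ∈ P1 M) : geodesicPush x t μ ∈ P1 M :=
  P1.map_mem hμ (hM.lipschitzWith_geodesicPoint x ht)

lemma wasserstein1_geodesicPush_le (hM : IsGlobalNPC M) (x y : M) (ht : t ∈ Icc (0 : ℝ) 1)
    (π : Measure (M × M)) [IsProbabilityMeasure π] :
    wasserstein1 (geodesicPush x t (π.map Prod.fst)) (geodesicPush y t (π.map Prod.snd)) ≤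
      ENNReal.ofReal (1 - t) * edist x y + ENNReal.ofReal t * ∫⁻ p, edist p.1 p.2 ∂π := by
  have hx := hM.measurable_geodesicPoint x ht
  have hy := hM.measurable_geodesicPoint y ht
  unfold geodesicPush
  rw [Measure.map_map hx measurable_fst, Measure.map_map hy measurable_snd]
  calc _ ≤ ∫⁻ p : M × M, edist (geodesicPoint x p.1 t) (geodesicPoint y p.2 t) ∂π :=
        wasserstein1_map_map_le (hx.comp measurable_fst).aemeasurable
          (hy.comp measurable_snd).aemeasurable
    _ ≤ ∫⁻ p : M × M, (ENNReal.ofReal (1 - t) * edist x y +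
          ENNReal.ofReal t * edist p.1 p.2) ∂π :=
        lintegral_mono fun p => hM.edist_geodesicPoint_geodesicPoint_le x p.1 y p.2 ht
    _ = _ := by
        rw [lintegral_add_left measurable_const, lintegral_const, measure_univ, mul_one,
          lintegral_const_mul' _ _ ENNReal.ofReal_ne_top]

lemma contractingWith_geodesicPush (hM : IsGlobalNPC M) (hβ : IsContractiveBarycentricMap β)
    (ht : t ∈ Ioc (0 : ℝ) 1) (hμ : μ ∈ P1 M) :
    ContractingWith (1 - t).toNNReal fun x => β (geodesicPush x t μ) := by
  have ht' : t ∈ Icc (0 : ℝ) 1 := Ioc_subset_Icc_self ht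
  have := hμ.1
  refine ⟨Real.toNNReal_lt_one.2 (sub_lt_self _ ht.1), fun x y => ?_⟩
  calc edist (β (geodesicPush x t μ)) (β (geodesicPush y t μ))
      ≤ wasserstein1 (geodesicPush x t μ) (geodesicPush y t μ) :=
        hβ.2 _ (hM.geodesicPush_mem_P1 x ht' hμ) _ (hM.geodesicPush_mem_P1 y ht' hμ)
    _ ≤ ∫⁻ a, edist (geodesicPoint x a t) (geodesicPoint y a t) ∂μ :=
        wasserstein1_map_map_le (hM.measurable_geodesicPoint x ht').aemeasurable
          (hM.measurable_geodesicPoint y ht').aemeasurable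
    _ ≤ ∫⁻ _, ENNReal.ofReal (1 - t) * edist x y ∂μ := lintegral_mono fun a => by
        simpa using hM.edist_geodesicPoint_geodesicPoint_le x a y a ht'
    _ = _ := by rw [lintegral_const, measure_univ, mul_one, ENNReal.ofReal]

theorem eq_barycenterFlow_iff (hM : IsGlobalNPC M) (hβ : IsContractiveBarycentricMap β)
    (ht : t ∈ Ioc (0 : ℝ) 1) (hμ : μ ∈ P1 M) (x : M) :
    x = barycenterFlow t β μ ↔ x = β (geodesicPush x t μ) := by
  have := hM.complete
  have hcontr := hM.contractingWith_geodesicPush hβ ht hμ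
  have hspec : barycenterFlow t β μ = β (geodesicPush (barycenterFlow t β μ) t μ) :=
    Classical.epsilon_spec (p := fun x : M => x = β (geodesicPush x t μ))
      ⟨_, hcontr.fixedPoint_isFixedPt.symm⟩
  exact ⟨fun h => h ▸ hspec, fun h => hcontr.fixedPoint_unique' h.symm hspec.symm⟩

lemma barycenterFlow_eq (hM : IsGlobalNPC M) (hβ : IsContractiveBarycentricMap β)
    (ht : t ∈ Ioc (0 : ℝ) 1) (hμ : μ ∈ P1 M) :
    barycenterFlow t β μ = β (geodesicPush (barycenterFlow t β μ) t μ) :=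
  (hM.eq_barycenterFlow_iff hβ ht hμ _).1 rfl

lemma barycenterFlow_dirac (hM : IsGlobalNPC M) (hβ : IsContractiveBarycentricMap β)
    (ht : t ∈ Ioc (0 : ℝ) 1) (x : M) : barycenterFlow t β (Measure.dirac x) = x := by
  have ht' : t ∈ Icc (0 : ℝ) 1 := Ioc_subset_Icc_self ht
  refine ((hM.eq_barycenterFlow_iff hβ ht (dirac_mem_P1 x) x).2 ?_).symm
  rw [geodesicPush, Measure.map_dirac' (hM.measurable_geodesicPoint x ht'),
    hM.geodesicPoint_self x ht', hβ.1]

lemma edist_barycenterFlow_le (hM : IsGlobalNPC M) (hβ : IsContractiveBarycentricMap β)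
    (ht : t ∈ Ioc (0 : ℝ) 1) (hμ : μ ∈ P1 M) (hν : ν ∈ P1 M) :
    edist (barycenterFlow t β μ) (barycenterFlow t β ν) ≤ wasserstein1 μ ν := by
  have ht' : t ∈ Icc (0 : ℝ) 1 := Ioc_subset_Icc_self ht
  refine le_iInf₂ fun π hπ => ?_
  have := hμ.1
  have : IsProbabilityMeasure (π.map Prod.fst) := hπ.1.symm ▸ this
  have : IsProbabilityMeasure π := Measure.isProbabilityMeasure_of_map Prod.fst
  have hpush := hM.wasserstein1_geodesicPush_le (barycenterFlow t β μ) (barycenterFlow t β ν) ht' π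
  rw [hπ.1, hπ.2] at hpush
  have hcontr := (hβ.2 _ (hM.geodesicPush_mem_P1 _ ht' hμ) _
    (hM.geodesicPush_mem_P1 _ ht' hν)).trans hpush
  rw [← hM.barycenterFlow_eq hβ ht hμ, ← hM.barycenterFlow_eq hβ ht hν] at hcontr
  set D := edist (barycenterFlow t β μ) (barycenterFlow t β ν)
  have hsplit : D = ENNReal.ofReal (1 - t) * D + ENNReal.ofReal t * D := by
    rw [← add_mul, ← ENNReal.ofReal_add (sub_nonneg.2 ht.2) ht.1.le, sub_add_cancel,
      ENNReal.ofReal_one, one_mul]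
  have hmul : ENNReal.ofReal t * D ≤ ENNReal.ofReal t * ∫⁻ p, edist p.1 p.2 ∂π :=
    (ENNReal.add_le_add_iff_left (ENNReal.mul_ne_top ENNReal.ofReal_ne_top (edist_ne_top _ _))).1
      (hsplit.symm.trans_le hcontr)
  exact (ENNReal.mul_le_mul_iff_right (by simpa using ht.1) ENNReal.ofReal_ne_top).1 hmul

theorem isContractiveBarycentricMap_barycenterFlow (hM : IsGlobalNPC M)
    (hβ : IsContractiveBarycentricMap β) (ht : t ∈ Ioc (0 : ℝ) 1) :
    IsContractiveBarycentricMap (barycenterFlow t β) :=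
  ⟨hM.barycenterFlow_dirac hβ ht, fun _ hμ _ hν => hM.edist_barycenterFlow_le hβ ht hμ hν⟩

lemma dist_barycenterFlow_le (hM : IsGlobalNPC M) (hβ : IsContractiveBarycentricMap β)
    (ht : t ∈ Ioc (0 : ℝ) 1) (hμ : μ ∈ P1 M) (b : M) :
    dist b (barycenterFlow t β μ) ≤
      ∫ a, dist b (geodesicPoint (barycenterFlow t β μ) a t) ∂μ := by
  have ht' : t ∈ Icc (0 : ℝ) 1 := Ioc_subset_Icc_self ht
  set x := barycenterFlow t β μ with hx
  calc dist b x = dist (β (geodesicPush x t μ)) b := by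
        rw [dist_comm, hx, ← hM.barycenterFlow_eq hβ ht hμ]
    _ ≤ ∫ a, dist b a ∂(geodesicPush x t μ) :=
        hβ.dist_dirac_le (hM.geodesicPush_mem_P1 x ht' hμ) b
    _ = _ := integral_map (hM.measurable_geodesicPoint x ht').aemeasurable
        (continuous_const.dist continuous_id).measurable.aestronglyMeasurable

lemma two_mul_dist_mul_integral_dist_geodesicPoint_le (hM : IsGlobalNPC M)
    (ht : t ∈ Icc (0 : ℝ) 1) (hμ : μ ∈ P1 M) {b x : M} {r : ℝ} (hr : ∀ᵐ a ∂μ, dist x a ≤ r) :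
    2 * dist b x * ∫ a, dist b (geodesicPoint x a t) ∂μ ≤
      2 * dist b x ^ 2 + t * (sqDistGap μ x b - dist b x ^ 2) + t ^ 2 * r ^ 2 := by
  have := hμ.1
  set D := dist b x with hD
  have hdist : Integrable (fun a => dist b (geodesicPoint x a t)) μ :=
    (P1.integrable_dist (hM.geodesicPush_mem_P1 x ht hμ) b).comp_measurable
      (hM.measurable_geodesicPoint x ht)
  have hgap := (integrable_sq_dist_sub hμ x b).const_mul t
  have hpointwise (a : M) (ha : dist x a ≤ r) : 2 * D * dist b (geodesicPoint x a t) ≤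
      t * (dist b a ^ 2 - dist x a ^ 2) + (2 * D ^ 2 - t * D ^ 2 + t ^ 2 * r ^ 2) := by
    have hnpc := hM.isNPCPoint_geodesicPoint x a ht b
    have hsq := mul_le_mul_of_nonneg_left (pow_le_pow_left₀ dist_nonneg ha 2) (sq_nonneg t)
    rw [← hD] at hnpc
    linarith [two_mul_le_add_sq D (dist b (geodesicPoint x a t))]
  calc 2 * D * ∫ a, dist b (geodesicPoint x a t) ∂μ
      = ∫ a, 2 * D * dist b (geodesicPoint x a t) ∂μ := (integral_const_mul _ _).symm
    _ ≤ ∫ a, (t * (dist b a ^ 2 - dist x a ^ 2) +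
          (2 * D ^ 2 - t * D ^ 2 + t ^ 2 * r ^ 2)) ∂μ :=
        integral_mono_ae (hdist.const_mul _) (hgap.add (integrable_const _)) (hr.mono hpointwise)
    _ = _ := by
        rw [integral_add hgap (integrable_const _), integral_const_mul]
        simp only [integral_const, probReal_univ, one_smul, sqDistGap]
        ring

lemma two_mul_sq_dist_canonicalBarycenter_barycenterFlow_le (hM : IsGlobalNPC M)
    (hβ : IsContractiveBarycentricMap β) (ht : t ∈ Ioc (0 : ℝ) 1) (hμ : μ ∈ P1 M) {x₀ : M}
    {R : ℝ} (hR : ∀ᵐ a ∂μ, dist x₀ a ≤ R) :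
    2 * dist (canonicalBarycenter μ) (barycenterFlow t β μ) ^ 2 ≤ t * (2 * R) ^ 2 := by
  have := hμ.1
  have hflow := hM.dist_barycenterFlow_le hβ ht hμ (canonicalBarycenter μ)
  have hvar := hM.sq_dist_le_sqDistGap hμ (hM.isCanonicalBarycenter_canonicalBarycenter hμ)
    (barycenterFlow t β μ)
  have hx₀ : dist (barycenterFlow t β μ) x₀ ≤ R := by
    refine ((hM.isContractiveBarycentricMap_barycenterFlow hβ ht).dist_dirac_le hμ x₀).trans ?_
    simpa using integral_mono_ae (P1.integrable_dist hμ x₀) (integrable_const R) hR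
  set b := canonicalBarycenter μ
  set x := barycenterFlow t β μ
  have hbound := hM.two_mul_dist_mul_integral_dist_geodesicPoint_le (b := b) (x := x)
    (Ioc_subset_Icc_self ht) hμ (r := 2 * R)
    (hR.mono fun a ha => (dist_triangle x x₀ a).trans (by linarith))
  have hgap : sqDistGap μ x b ≤ -dist b x ^ 2 := by
    linarith [sqDistGap_add hμ x b x, sqDistGap_self μ x]
  have hflow' := mul_le_mul_of_nonneg_left hflow (by positivity : 0 ≤ 2 * dist b x)
  have hgap' := mul_le_mul_of_nonneg_left hgap ht.1.le
  refine le_of_mul_le_mul_left ?_ ht.1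
  linarith

lemma tendsto_barycenterFlow_of_ae_dist_le (hM : IsGlobalNPC M)
    (hβ : IsContractiveBarycentricMap β) (hμ : μ ∈ P1 M) {x₀ : M} {R : ℝ}
    (hR : ∀ᵐ a ∂μ, dist x₀ a ≤ R) :
    Tendsto (fun t : ℝ => barycenterFlow t β μ) (𝓝[>] 0) (𝓝 (canonicalBarycenter μ)) := by
  have hbound : Tendsto (fun t : ℝ => √(t * (2 * R) ^ 2)) (𝓝[>] 0) (𝓝 0) :=
    (Continuous.tendsto' (by fun_prop) _ _ (by simp)).mono_left nhdsWithin_le_nhds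
  refine tendsto_iff_dist_tendsto_zero.2 (squeeze_zero' (.of_forall fun t => dist_nonneg) ?_ hbound)
  filter_upwards [Ioc_mem_nhdsGT one_pos] with t ht
  rw [dist_comm]
  refine Real.le_sqrt_of_sq_le ?_
  linarith [hM.two_mul_sq_dist_canonicalBarycenter_barycenterFlow_le hβ ht hμ hR,
    sq_nonneg (dist (canonicalBarycenter μ) (barycenterFlow t β μ))]

theorem tendsto_barycenterFlow (hM : IsGlobalNPC M)
    (hβ : IsContractiveBarycentricMap β) (hμ : μ ∈ P1 M) :
    Tendsto (fun t : ℝ => barycenterFlow t β μ) (𝓝[>] 0) (𝓝 (canonicalBarycenter μ)) := by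
  have := hμ.1
  obtain ⟨x₀⟩ := ‹Nonempty M›
  rw [tendsto_iff_edist_tendsto_0, ENNReal.tendsto_nhds_zero]
  intro ε hε
  have hε3 : 0 < ε / 3 := ENNReal.div_pos hε.ne' (by simp)
  obtain ⟨ψ, hψ⟩ := (P1.memL1 hμ).exists_simpleFunc_distL1_le hε3
  have hν : μ.map ψ ∈ P1 M := (memL1_simpleFunc x₀ ψ).map_mem_P1
  have hμν : wasserstein1 μ (μ.map ψ) ≤ ε / 3 := by
    have hle := wasserstein1_map_map_le (P := μ) aemeasurable_id ψ.measurable.aemeasurable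
    rw [Measure.map_id] at hle
    exact hle.trans hψ
  have hR : ∀ᵐ a ∂(μ.map ψ), dist x₀ a ≤ ∑ y ∈ ψ.range, dist x₀ y := by
    refine (ae_map_iff ψ.measurable.aemeasurable (measurableSet_le
      (continuous_const.dist continuous_id).measurable measurable_const)).2 (.of_forall fun a => ?_)
    exact Finset.single_le_sum (f := dist x₀) (fun _ _ => dist_nonneg) (ψ.mem_range_self a)
  have hconv := tendsto_iff_edist_tendsto_0.1 (hM.tendsto_barycenterFlow_of_ae_dist_le hβ hν hR)
  filter_upwards [Ioc_mem_nhdsGT one_pos, ENNReal.tendsto_nhds_zero.1 hconv _ hε3] with t ht hclose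
  calc _ ≤ edist (barycenterFlow t β μ) (barycenterFlow t β (μ.map ψ)) +
          edist (barycenterFlow t β (μ.map ψ)) (canonicalBarycenter (μ.map ψ)) +
          edist (canonicalBarycenter (μ.map ψ)) (canonicalBarycenter μ) := edist_triangle4 _ _ _ _
    _ ≤ ε / 3 + ε / 3 + ε / 3 := by
        gcongr
        · exact (hM.edist_barycenterFlow_le hβ ht hμ hν).trans hμν
        · exact (edist_comm _ _).trans_le ((hM.edist_canonicalBarycenter_le hμ hν).trans hμν)
    _ = ε := ENNReal.add_thirds ε

end IsGlobalNPC

end Flow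

/-! ### The maximal ergodic theorem and Birkhoff's theorem for bounded functions -/

section Birkhoff

variable {Ω : Type*} {T : Ω → Ω} {f : Ω → ℝ}

/-- The maximum of `0` and the Birkhoff sums of length at most `n`. -/
noncomputable def maxBirkhoffSum (T : Ω → Ω) (f : Ω → ℝ) : ℕ → Ω → ℝ
  | 0 => fun _ => 0
  | n + 1 => fun ω => max 0 (f ω + maxBirkhoffSum T f n (T ω))

lemma maxBirkhoffSum_nonneg (T : Ω → Ω) (f : Ω → ℝ) (n : ℕ) (ω : Ω) :
    0 ≤ maxBirkhoffSum T f n ω := by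
  cases n with
  | zero => exact le_rfl
  | succ n => exact le_max_left _ _

lemma monotone_maxBirkhoffSum (T : Ω → Ω) (f : Ω → ℝ) (ω : Ω) :
    Monotone fun n => maxBirkhoffSum T f n ω := by
  refine monotone_nat_of_le_succ fun n => ?_
  induction n generalizing ω with
  | zero => exact maxBirkhoffSum_nonneg T f 1 ω
  | succ n ih => exact max_le_max le_rfl (add_le_add le_rfl (ih (T ω)))

lemma birkhoffSum_le_maxBirkhoffSum (T : Ω → Ω) (f : Ω → ℝ) (n : ℕ) (ω : Ω) :
    birkhoffSum T f n ω ≤ maxBirkhoffSum T f n ω := by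
  induction n generalizing ω with
  | zero => exact (birkhoffSum_zero T f ω).le
  | succ n ih =>
    rw [birkhoffSum_succ']
    exact (add_le_add le_rfl (ih (T ω))).trans (le_max_right _ _)

lemma maxBirkhoffSum_le_of_pos {n : ℕ} {ω : Ω} (h : 0 < maxBirkhoffSum T f n ω) :
    maxBirkhoffSum T f n ω ≤ f ω + maxBirkhoffSum T f n (T ω) := by
  cases n with
  | zero => exact absurd h (lt_irrefl (0 : ℝ))
  | succ n =>
    have hpos : 0 < f ω + maxBirkhoffSum T f n (T ω) := (lt_max_iff.1 h).resolve_left (lt_irrefl 0)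
    exact (max_eq_right hpos.le).trans_le
      (add_le_add le_rfl (monotone_maxBirkhoffSum T f (T ω) n.le_succ))

lemma birkhoffSum_const_sub (T : Ω → Ω) (f : Ω → ℝ) (a : ℝ) (n : ℕ) (ω : Ω) :
    birkhoffSum T (fun ω => a - f ω) n ω = n * a - birkhoffSum T f n ω := by
  simp [birkhoffSum, Finset.sum_sub_distrib]

lemma abs_birkhoffAverage_le {C : ℝ} (hf : ∀ ω, |f ω| ≤ C) (n : ℕ) (ω : Ω) :
    |birkhoffAverage ℝ T f n ω| ≤ C := by
  rcases Nat.eq_zero_or_pos n with rfl | hn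
  · simpa using (abs_nonneg _).trans (hf ω)
  · have hn' : (0 : ℝ) < n := Nat.cast_pos.2 hn
    rw [birkhoffAverage, smul_eq_mul, abs_mul, abs_inv, Nat.abs_cast, inv_mul_le_iff₀ hn']
    refine (Finset.abs_sum_le_sum_abs _ _).trans ((Finset.sum_le_sum fun k _ => hf _).trans ?_)
    simp

/-- The set of `ω` at which the lower limit of the Birkhoff averages is less than `a`. The rational
`q` leaves room for perturbing the averages. -/
def birkhoffLowSet (T : Ω → Ω) (f : Ω → ℝ) (a : ℝ) : Set Ω :=
  {ω | ∃ q : ℚ, (q : ℝ) < a ∧ ∃ᶠ n in atTop, birkhoffAverage ℝ T f n ω < q}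

lemma mem_birkhoffLowSet_of_tendsto_sub {ω ω' : Ω} {a : ℝ}
    (h : Tendsto (fun n => birkhoffAverage ℝ T f n ω' - birkhoffAverage ℝ T f n ω) atTop (𝓝 0))
    (hω : ω ∈ birkhoffLowSet T f a) : ω' ∈ birkhoffLowSet T f a := by
  obtain ⟨q, hqa, hq⟩ := hω
  obtain ⟨r, hqr, hra⟩ := exists_rat_btwn hqa
  refine ⟨r, hra, (hq.and_eventually (h.eventually_lt_const (sub_pos.2 hqr))).mono fun n hn => ?_⟩
  linarith [hn.1, hn.2]

lemma preimage_birkhoffLowSet (hf : Bornology.IsBounded (range f)) (a : ℝ) :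
    T ⁻¹' birkhoffLowSet T f a = birkhoffLowSet T f a := by
  ext ω
  have h : Tendsto (fun n => birkhoffAverage ℝ T f n (T ω) - birkhoffAverage ℝ T f n ω)
      atTop (𝓝 0) := tendsto_birkhoffAverage_apply_sub_birkhoffAverage' ℝ hf T ω
  exact ⟨mem_birkhoffLowSet_of_tendsto_sub (by simpa using h.neg),
    mem_birkhoffLowSet_of_tendsto_sub h⟩

lemma exists_birkhoffSum_pos_of_mem_birkhoffLowSet {ω : Ω} {a : ℝ}
    (hω : ω ∈ birkhoffLowSet T f a) : ∃ n, 0 < birkhoffSum T (fun ω => a - f ω) n ω := by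
  obtain ⟨q, hqa, hq⟩ := hω
  obtain ⟨n, hn, hn0⟩ := (hq.and_eventually (eventually_gt_atTop 0)).exists
  have hn' : (0 : ℝ) < n := Nat.cast_pos.2 hn0
  have hsum : birkhoffSum T f n ω < n * q := by
    rwa [birkhoffAverage, smul_eq_mul, inv_mul_lt_iff₀ hn'] at hn
  refine ⟨n, ?_⟩
  rw [birkhoffSum_const_sub]
  linarith [mul_lt_mul_of_pos_left hqa hn']

lemma exists_tendsto_birkhoffAverage_of_notMem {C : ℝ} (hf : ∀ ω, |f ω| ≤ C) {ω : Ω}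
    (hω : ∀ a b : ℚ, (a : ℝ) < b → ω ∉ birkhoffLowSet T f a ∩ birkhoffLowSet T (-f) (-b)) :
    ∃ l, Tendsto (fun n => birkhoffAverage ℝ T f n ω) atTop (𝓝 l) := by
  have hbound (n : ℕ) := abs_le.1 (abs_birkhoffAverage_le (T := T) hf n ω)
  refine tendsto_of_no_upcrossings (s := range ((↑) : ℚ → ℝ)) Rat.isDenseEmbedding_coe_real.dense ?_
    (isBoundedUnder_of ⟨C, fun n => (hbound n).2⟩) (isBoundedUnder_of ⟨-C, fun n => (hbound n).1⟩)
  rintro _ ⟨a, rfl⟩ _ ⟨b, rfl⟩ hab ⟨hlow, hhigh⟩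
  obtain ⟨a', haa', ha'b⟩ := exists_rat_btwn hab
  obtain ⟨b', ha'b', hb'b⟩ := exists_rat_btwn ha'b
  refine hω a' b' ha'b' ⟨⟨a, haa', hlow⟩, -b, by simpa using hb'b, hhigh.mono fun n hn => ?_⟩
  simpa [birkhoffAverage_neg] using hn

variable [MeasurableSpace Ω] {P : Measure Ω}

lemma measurable_maxBirkhoffSum (hT : Measurable T) (hf : Measurable f) (n : ℕ) :
    Measurable (maxBirkhoffSum T f n) := by
  induction n with
  | zero => exact measurable_const
  | succ n ih => exact measurable_const.max (hf.add (ih.comp hT))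

lemma integrable_maxBirkhoffSum (hT : MeasurePreserving T P P) (hf : Integrable f P) (n : ℕ) :
    Integrable (maxBirkhoffSum T f n) P := by
  induction n with
  | zero => exact integrable_zero _ _ _
  | succ n ih => exact (integrable_zero _ _ _).sup (hf.add (hT.integrable_comp_of_integrable ih))

lemma setIntegral_maxBirkhoffSum_pos_nonneg (hT : MeasurePreserving T P P) (hfm : Measurable f)
    (hf : Integrable f P) (n : ℕ) : 0 ≤ ∫ ω in {ω | 0 < maxBirkhoffSum T f n ω}, f ω ∂P := by
  set m := maxBirkhoffSum T f n
  have hm : Measurable m := measurable_maxBirkhoffSum hT.measurable hfm n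
  have hint : Integrable m P := integrable_maxBirkhoffSum hT hf n
  have hintT : Integrable (fun ω => m (T ω)) P := hT.integrable_comp_of_integrable hint
  have hpos : MeasurableSet {ω | 0 < m ω} := measurableSet_lt measurable_const hm
  have hle : ∫ ω, m ω ∂P ≤ ∫ ω in {ω | 0 < m ω}, f ω ∂P + ∫ ω, m ω ∂P :=
    calc ∫ ω, m ω ∂P = ∫ ω in {ω | 0 < m ω}, m ω ∂P :=
          (setIntegral_eq_integral_of_forall_compl_eq_zero fun ω hω =>
            le_antisymm (not_lt.1 hω) (maxBirkhoffSum_nonneg T f n ω)).symm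
      _ ≤ ∫ ω in {ω | 0 < m ω}, (f ω + m (T ω)) ∂P :=
          setIntegral_mono_on hint.integrableOn (hf.add hintT).integrableOn hpos fun ω hω =>
            maxBirkhoffSum_le_of_pos hω
      _ = ∫ ω in {ω | 0 < m ω}, f ω ∂P + ∫ ω in {ω | 0 < m ω}, m (T ω) ∂P :=
          integral_add hf.integrableOn hintT.integrableOn
      _ ≤ ∫ ω in {ω | 0 < m ω}, f ω ∂P + ∫ ω, m (T ω) ∂P :=
          add_le_add le_rfl (setIntegral_le_integral hintT
            (.of_forall fun ω => maxBirkhoffSum_nonneg T f n (T ω)))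
      _ = _ := by
          rw [← integral_map hT.aemeasurable hm.aestronglyMeasurable, hT.map_eq]
  linarith

/-- The maximal ergodic theorem. -/
theorem setIntegral_exists_maxBirkhoffSum_pos_nonneg (hT : MeasurePreserving T P P)
    (hfm : Measurable f) (hf : Integrable f P) :
    0 ≤ ∫ ω in {ω | ∃ n, 0 < maxBirkhoffSum T f n ω}, f ω ∂P := by
  rw [ofPred_exists]
  refine ge_of_tendsto' (tendsto_setIntegral_of_monotone (fun n => ?_) ?_ hf.integrableOn)
    (setIntegral_maxBirkhoffSum_pos_nonneg hT hfm hf)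
  · exact measurableSet_lt measurable_const (measurable_maxBirkhoffSum hT.measurable hfm n)
  · exact fun n m hnm ω hω => lt_of_lt_of_le hω (monotone_maxBirkhoffSum T f ω hnm)

lemma integral_nonneg_of_exists_birkhoffSum_pos (hT : MeasurePreserving T P P)
    (hfm : Measurable f) (hf : Integrable f P) (h : ∀ᵐ ω ∂P, ∃ n, 0 < birkhoffSum T f n ω) :
    0 ≤ ∫ ω, f ω ∂P := by
  have hmaximal := setIntegral_exists_maxBirkhoffSum_pos_nonneg hT hfm hf
  rwa [setIntegral_eq_integral_of_ae_compl_eq_zero] at hmaximal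
  filter_upwards [h] with ω ⟨n, hn⟩ hω
  exact absurd ⟨n, hn.trans_le (birkhoffSum_le_maxBirkhoffSum T f n ω)⟩ hω

theorem measure_exists_lt_birkhoffSum_le [IsFiniteMeasure P] (hT : MeasurePreserving T P P)
    (hfm : Measurable f) (hf : Integrable f P) (hf0 : 0 ≤ f) {c : ℝ} (hc : 0 < c) :
    P {ω | ∃ n : ℕ, n * c < birkhoffSum T f n ω} ≤ ENNReal.ofReal ((∫ ω, f ω ∂P) / c) := by
  set g : Ω → ℝ := fun ω => f ω - c
  set E := {ω | ∃ n, 0 < maxBirkhoffSum T g n ω}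
  have hsubset : {ω | ∃ n : ℕ, n * c < birkhoffSum T f n ω} ⊆ E := by
    rintro ω ⟨n, hn⟩
    refine ⟨n, lt_of_lt_of_le ?_ (birkhoffSum_le_maxBirkhoffSum T g n ω)⟩
    simpa [birkhoffSum, g, Finset.sum_sub_distrib] using hn
  have hmaximal : 0 ≤ ∫ ω in E, g ω ∂P :=
    setIntegral_exists_maxBirkhoffSum_pos_nonneg hT (hfm.sub_const c)
      (hf.sub (integrable_const c))
  have hsub : ∫ ω in E, g ω ∂P = ∫ ω in E, f ω ∂P - P.real E * c := by
    rw [integral_sub hf.integrableOn (integrable_const c)]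
    simp
  have hle : ∫ ω in E, f ω ∂P ≤ ∫ ω, f ω ∂P := setIntegral_le_integral hf (.of_forall hf0)
  have hE : P.real E ≤ (∫ ω, f ω ∂P) / c := by
    rw [le_div_iff₀ hc]
    linarith
  exact (measure_mono hsubset).trans ((ofReal_measureReal (measure_ne_top P E)).ge.trans
    (ENNReal.ofReal_le_ofReal hE))

lemma measurable_birkhoffAverage (hT : Measurable T) (hf : Measurable f) (n : ℕ) :
    Measurable (birkhoffAverage ℝ T f n) :=
  (Finset.measurable_sum _ fun k _ => hf.comp (hT.iterate k)).const_smul (n : ℝ)⁻¹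

lemma measurableSet_birkhoffLowSet (hT : Measurable T) (hf : Measurable f) (a : ℝ) :
    MeasurableSet (birkhoffLowSet T f a) := by
  have hunion : birkhoffLowSet T f a = ⋃ q : ℚ, ⋃ _ : (q : ℝ) < a,
      ⋂ N : ℕ, ⋃ n : ℕ, ⋃ _ : N ≤ n, {ω | birkhoffAverage ℝ T f n ω < q} := by
    ext ω
    simp [birkhoffLowSet, frequently_atTop]
  rw [hunion]
  refine .iUnion fun q => .iUnion fun _ => .iInter fun N => .iUnion fun n => .iUnion fun _ => ?_
  exact measurableSet_lt (measurable_birkhoffAverage hT hf n) measurable_const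

/-- The maximal ergodic theorem on the invariant set `E` where the averages oscillate across
`[a, b]` gives `b * P E ≤ ∫_E f ≤ a * P E`. -/
lemma measure_birkhoffLowSet_inter_eq_zero [IsFiniteMeasure P] (hT : MeasurePreserving T P P)
    (hfm : Measurable f) {C : ℝ} (hf : ∀ ω, |f ω| ≤ C) {a b : ℝ} (hab : a < b) :
    P (birkhoffLowSet T f a ∩ birkhoffLowSet T (-f) (-b)) = 0 := by
  set E := birkhoffLowSet T f a ∩ birkhoffLowSet T (-f) (-b)
  have hE : MeasurableSet E := (measurableSet_birkhoffLowSet hT.measurable hfm a).inter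
    (measurableSet_birkhoffLowSet hT.measurable hfm.neg (-b))
  have hTE : MeasurePreserving T (P.restrict E) (P.restrict E) := by
    have hbdd : Bornology.IsBounded (range f) :=
      isBounded_iff_forall_norm_le.2 ⟨C, forall_mem_range.2 hf⟩
    have hbdd_neg : Bornology.IsBounded (range (-f)) := isBounded_iff_forall_norm_le.2
      ⟨C, forall_mem_range.2 fun ω => (abs_neg (f ω)).trans_le (hf ω)⟩
    have h := hT.restrict_preimage hE
    rwa [preimage_inter, preimage_birkhoffLowSet hbdd, preimage_birkhoffLowSet hbdd_neg] at h
  have hint : Integrable f (P.restrict E) := .of_bound hfm.aestronglyMeasurable C (.of_forall hf)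
  have hlow : 0 ≤ ∫ ω in E, (a - f ω) ∂P :=
    integral_nonneg_of_exists_birkhoffSum_pos hTE (measurable_const.sub hfm)
      ((integrable_const a).sub hint) ((ae_restrict_mem hE).mono fun ω hω =>
        exists_birkhoffSum_pos_of_mem_birkhoffLowSet hω.1)
  have hhigh : 0 ≤ ∫ ω in E, (-b - (-f) ω) ∂P :=
    integral_nonneg_of_exists_birkhoffSum_pos hTE (measurable_const.sub hfm.neg)
      ((integrable_const (-b)).sub hint.neg) ((ae_restrict_mem hE).mono fun ω hω =>
        exists_birkhoffSum_pos_of_mem_birkhoffLowSet hω.2)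
  rw [integral_sub (integrable_const _) hint] at hlow
  rw [integral_sub (integrable_const _) hint.neg] at hhigh
  simp only [integral_const, smul_eq_mul, measureReal_restrict_apply_univ, Pi.neg_apply,
    integral_neg] at hlow hhigh
  have hnonpos : P.real E * (b - a) ≤ 0 := by linarith
  exact (measureReal_eq_zero_iff (measure_ne_top P E)).1 (le_antisymm
    (nonpos_of_mul_nonpos_left hnonpos (sub_pos.2 hab)) measureReal_nonneg)

theorem ae_exists_tendsto_birkhoffAverage [IsFiniteMeasure P] (hT : MeasurePreserving T P P)
    (hfm : Measurable f) {C : ℝ} (hf : ∀ ω, |f ω| ≤ C) :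
    ∀ᵐ ω ∂P, ∃ l, Tendsto (fun n => birkhoffAverage ℝ T f n ω) atTop (𝓝 l) := by
  have hnull : ∀ᵐ ω ∂P, ∀ a b : ℚ, (a : ℝ) < b →
      ω ∉ birkhoffLowSet T f a ∩ birkhoffLowSet T (-f) (-b) :=
    ae_all_iff.2 fun a => ae_all_iff.2 fun b => eventually_imp_distrib_left.2 fun hab =>
      measure_eq_zero_iff_ae_notMem.1 (measure_birkhoffLowSet_inter_eq_zero hT hfm hf hab)
  exact hnull.mono fun ω => exists_tendsto_birkhoffAverage_of_notMem hf

end Birkhoff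

/-! ### Empirical measures -/

section StronglyMeasurablePi

variable {ι Ω : Type*} [Finite ι] {X : ι → Type*} [∀ i, TopologicalSpace (X i)]
  [MeasurableSpace Ω] {f : ∀ i, Ω → X i}

lemma stronglyMeasurable_pi (hf : ∀ i, StronglyMeasurable (f i)) :
    StronglyMeasurable fun ω i => f i ω := by
  refine ⟨fun n => ⟨fun ω i => (hf i).approx n ω, fun y => ?_, ?_⟩,
    fun ω => tendsto_pi_nhds.2 fun i => (hf i).tendsto_approx ω⟩
  · have hfiber : (fun ω i => (hf i).approx n ω) ⁻¹' {y} =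
        ⋂ i, (hf i).approx n ⁻¹' {y i} := by
      ext ω
      simp [funext_iff]
    rw [hfiber]
    exact .iInter fun i => ((hf i).approx n).measurableSet_fiber (y i)
  · refine (Set.Finite.pi' fun i => ((hf i).approx n).finite_range).subset ?_
    rintro _ ⟨ω, rfl⟩ i
    exact mem_range_self ω

lemma aestronglyMeasurable_pi {P : Measure Ω} (hf : ∀ i, AEStronglyMeasurable (f i) P) :
    AEStronglyMeasurable (fun ω i => f i ω) P :=
  ⟨fun ω i => (hf i).mk (f i) ω, stronglyMeasurable_pi fun i => (hf i).stronglyMeasurable_mk,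
    (ae_all_iff.2 fun i => (hf i).ae_eq_mk).mono fun _ h => funext h⟩

end StronglyMeasurablePi

section ENNRealBirkhoffAverage

variable {Ω : Type*} {T : Ω → Ω}

lemma birkhoffAverage_ennreal (T : Ω → Ω) (f : Ω → ℝ≥0∞) (n : ℕ) (ω : Ω) :
    birkhoffAverage NNReal T f n ω = (n : ℝ≥0∞)⁻¹ * ∑ k ∈ Finset.range n, f (T^[k] ω) := by
  rcases eq_or_ne n 0 with rfl | hn
  · simp
  · rw [birkhoffAverage, birkhoffSum, ENNReal.smul_def, smul_eq_mul,
      ENNReal.coe_inv (Nat.cast_ne_zero.2 hn), ENNReal.coe_natCast]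

lemma ofReal_birkhoffAverage (T : Ω → Ω) {f : Ω → ℝ} (hf : 0 ≤ f) (n : ℕ) (ω : Ω) :
    ENNReal.ofReal (birkhoffAverage ℝ T f n ω) =
      birkhoffAverage NNReal T (fun ω => ENNReal.ofReal (f ω)) n ω := by
  rcases Nat.eq_zero_or_pos n with rfl | hn
  · simp
  · rw [birkhoffAverage_ennreal, birkhoffAverage, birkhoffSum, smul_eq_mul,
      ENNReal.ofReal_mul (by positivity), ENNReal.ofReal_inv_of_pos (Nat.cast_pos.2 hn),
      ENNReal.ofReal_natCast, ENNReal.ofReal_sum_of_nonneg fun k _ => hf _]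

lemma birkhoffAverage_le_of_le {f : Ω → ℝ≥0∞} {C : ℝ≥0∞} (hf : ∀ ω, f ω ≤ C) (n : ℕ) (ω : Ω) :
    birkhoffAverage NNReal T f n ω ≤ C := by
  rw [birkhoffAverage_ennreal]
  calc (n : ℝ≥0∞)⁻¹ * ∑ k ∈ Finset.range n, f (T^[k] ω) ≤ (n : ℝ≥0∞)⁻¹ * (n * C) := by
        gcongr
        simpa using Finset.sum_le_card_nsmul (Finset.range n) _ C fun k _ => hf _
    _ ≤ C := by
        rw [← mul_assoc]
        exact mul_le_of_le_one_left zero_le (ENNReal.inv_mul_le_one _)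

lemma lintegral_birkhoffAverage_le [MeasurableSpace Ω] {P : Measure Ω}
    (hT : MeasurePreserving T P P) {f : Ω → ℝ≥0∞} (hf : AEMeasurable f P) (n : ℕ) :
    ∫⁻ ω, birkhoffAverage NNReal T f n ω ∂P ≤ ∫⁻ ω, f ω ∂P := by
  have hfT (k : ℕ) : AEMeasurable (fun ω => f (T^[k] ω)) P :=
    hf.comp_quasiMeasurePreserving (hT.iterate k).quasiMeasurePreserving
  have hint (k : ℕ) : ∫⁻ ω, f (T^[k] ω) ∂P = ∫⁻ ω, f ω ∂P := by
    have hk := hT.iterate k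
    rw [← lintegral_map' (by rwa [hk.map_eq]) hk.aemeasurable, hk.map_eq]
  simp only [birkhoffAverage_ennreal]
  rw [lintegral_const_mul'' _ (Finset.aemeasurable_fun_sum _ fun k _ => hfT k),
    lintegral_finsetSum' _ fun k _ => hfT k]
  simp only [hint, Finset.sum_const, Finset.card_range, nsmul_eq_mul]
  rw [← mul_assoc]
  exact mul_le_of_le_one_left zero_le (ENNReal.inv_mul_le_one _)

end ENNRealBirkhoffAverage

lemma lintegral_uniformOn_univ {ι : Type*} [Fintype ι] [MeasurableSpace ι]
    [MeasurableSingletonClass ι] (f : ι → ℝ≥0∞) :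
    ∫⁻ i, f i ∂ProbabilityTheory.uniformOn univ = (Fintype.card ι : ℝ≥0∞)⁻¹ * ∑ i, f i := by
  simp [ProbabilityTheory.uniformOn, ProbabilityTheory.cond, lintegral_smul_measure,
    lintegral_count, tsum_fintype]

section EmpiricalMeasure

variable {M Ω : Type*} [MeasurableSpace M]

lemma empiricalMeasure_eq_map (T : Ω → Ω) (φ : Ω → M) (n : ℕ) (ω : Ω) :
    empiricalMeasure T φ n ω =
      (ProbabilityTheory.uniformOn univ).map fun k : Fin n => φ (T^[k] ω) := by
  refine Measure.ext_of_lintegral _ fun f hf => ?_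
  rw [lintegral_map hf (measurable_of_countable _), lintegral_uniformOn_univ,
    empiricalMeasure, lintegral_smul_measure, lintegral_finsetSum_measure, Fintype.card_fin,
    Fin.sum_univ_eq_sum_range fun k => f (φ (T^[k] ω))]
  simp [lintegral_dirac' _ hf]

lemma empiricalMeasure_const (T : Ω → Ω) (x : M) {n : ℕ} (hn : n ≠ 0) (ω : Ω) :
    empiricalMeasure T (fun _ => x) n ω = Measure.dirac x := by
  simp only [empiricalMeasure, Finset.sum_const, Finset.card_range]
  rw [← Nat.cast_smul_eq_nsmul ℝ≥0∞, smul_smul,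
    ENNReal.inv_mul_cancel (Nat.cast_ne_zero.2 hn) (ENNReal.natCast_ne_top n), one_smul]

/-- The proportion of the first `n` points of the orbit of `ω` that lie in `s`. -/
noncomputable def visitFrequency (T : Ω → Ω) (s : Set Ω) (n : ℕ) (ω : Ω) : ℝ≥0∞ :=
  birkhoffAverage NNReal T (s.indicator 1) n ω

lemma empiricalMeasure_simpleFunc [MeasurableSpace Ω] (T : Ω → Ω) (ψ : SimpleFunc Ω M) (n : ℕ)
    (ω : Ω) : empiricalMeasure T ψ n ω =
      ∑ x ∈ ψ.range, visitFrequency T (ψ ⁻¹' {x}) n ω • Measure.dirac x := by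
  classical
  simp only [empiricalMeasure, visitFrequency, birkhoffAverage_ennreal, ← smul_smul,
    ← Finset.smul_sum, Finset.sum_smul]
  rw [Finset.sum_comm]
  congr 1
  refine Finset.sum_congr rfl fun k _ => ?_
  simp [indicator_apply]

lemma ae_exists_tendsto_visitFrequency [MeasurableSpace Ω] {P : Measure Ω} [IsFiniteMeasure P]
    {T : Ω → Ω} (hT : MeasurePreserving T P P) {s : Set Ω} (hs : MeasurableSet s) :
    ∀ᵐ ω ∂P, ∃ l ≠ ∞, Tendsto (fun n => visitFrequency T s n ω) atTop (𝓝 l) := by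
  have hbound (ω : Ω) : |s.indicator (1 : Ω → ℝ) ω| ≤ 1 := by
    by_cases h : ω ∈ s <;> simp [h]
  filter_upwards [ae_exists_tendsto_birkhoffAverage hT (measurable_one.indicator hs) hbound]
    with ω ⟨l, hl⟩
  refine ⟨ENNReal.ofReal l, ENNReal.ofReal_ne_top, ?_⟩
  refine (ENNReal.tendsto_ofReal hl).congr fun n => ?_
  have hnonneg : 0 ≤ s.indicator (1 : Ω → ℝ) := indicator_nonneg fun _ _ => zero_le_one
  rw [ofReal_birkhoffAverage T hnonneg, visitFrequency]
  congr 1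
  ext ω
  by_cases h : ω ∈ s <;> simp [h]

end EmpiricalMeasure

section EmpiricalMeasureMetric

variable {M Ω : Type*} [MetricSpace M] [MeasurableSpace M] [BorelSpace M] {ι : Type*} [Finite ι]
  [Nonempty ι] [MeasurableSpace ι] [MeasurableSingletonClass ι]

lemma map_uniformOn_univ_mem_P1 (u : ι → M) :
    (ProbabilityTheory.uniformOn univ).map u ∈ P1 M := by
  have := ProbabilityTheory.isProbabilityMeasure_uniformOn (finite_univ (α := ι)) univ_nonempty
  exact (memL1_simpleFunc (u (Classical.arbitrary ι)) (SimpleFunc.ofFinite u)).map_mem_P1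

lemma empiricalMeasure_mem_P1 (T : Ω → Ω) (φ : Ω → M) {n : ℕ} (hn : n ≠ 0) (ω : Ω) :
    empiricalMeasure T φ n ω ∈ P1 M := by
  have : NeZero n := ⟨hn⟩
  rw [empiricalMeasure_eq_map]
  exact map_uniformOn_univ_mem_P1 _

lemma sum_visitFrequency [MeasurableSpace Ω] (T : Ω → Ω) (ψ : SimpleFunc Ω M) {n : ℕ}
    (hn : n ≠ 0) (ω : Ω) : ∑ x ∈ ψ.range, visitFrequency T (ψ ⁻¹' {x}) n ω = 1 := by
  have h := (empiricalMeasure_mem_P1 T ψ hn ω).1.measure_univ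
  rw [empiricalMeasure_simpleFunc] at h
  simpa [Measure.coe_finsetSum, Finset.sum_apply] using h

lemma tendsto_wasserstein1_empiricalMeasure_simpleFunc [MeasurableSpace Ω] {T : Ω → Ω}
    {ψ : SimpleFunc Ω M} {ω : Ω} (h : ∀ x ∈ ψ.range, ∃ l ≠ ∞,
      Tendsto (fun n => visitFrequency T (ψ ⁻¹' {x}) n ω) atTop (𝓝 l)) :
    Tendsto (fun p : ℕ × ℕ =>
      wasserstein1 (empiricalMeasure T ψ p.1 ω) (empiricalMeasure T ψ p.2 ω))
      (atTop ×ˢ atTop) (𝓝 0) := by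
  set a : ℕ → M → ℝ≥0∞ := fun n x => visitFrequency T (ψ ⁻¹' {x}) n ω
  have hfinite : ∀ n ≠ 0, ∀ x ∈ ψ.range, a n x ≠ ∞ := fun n hn x hx =>
    ne_top_of_le_ne_top ENNReal.one_ne_top (sum_visitFrequency T ψ hn ω ▸
      Finset.single_le_sum (f := a n) (fun _ _ => zero_le) hx)
  have hterm {u v : ℕ × ℕ → ℕ} (hu : Tendsto u (atTop ×ˢ atTop) atTop)
      (hv : Tendsto v (atTop ×ˢ atTop) atTop) : Tendsto (fun p =>
        ∑ x ∈ ψ.range, (a (u p) x - a (v p) x) * edist (ψ ω) x) (atTop ×ˢ atTop) (𝓝 0) := by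
    rw [← Finset.sum_const_zero (s := ψ.range)]
    refine tendsto_finsetSum _ fun x hx => ?_
    obtain ⟨l, hl, hlim⟩ := h x hx
    simpa using ENNReal.Tendsto.mul_const
      (ENNReal.Tendsto.sub (hlim.comp hu) (hlim.comp hv) (.inl hl))
      (.inr (edist_ne_top (ψ ω) x))
  refine tendsto_of_tendsto_of_tendsto_of_le_of_le' tendsto_const_nhds
    ((add_zero (0 : ℝ≥0∞)) ▸ (hterm tendsto_fst tendsto_snd).add (hterm tendsto_snd tendsto_fst))
    (.of_forall fun _ => zero_le) ?_
  filter_upwards [(eventually_ne_atTop 0).prod_mk (eventually_ne_atTop 0)] with p ⟨hp₁, hp₂⟩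
  simp only [empiricalMeasure_simpleFunc]
  exact wasserstein1_sum_dirac_le (hfinite _ hp₁) (hfinite _ hp₂)
    ((sum_visitFrequency T ψ hp₁ ω).trans (sum_visitFrequency T ψ hp₂ ω).symm) (ψ ω)

lemma ae_tendsto_wasserstein1_empiricalMeasure_simpleFunc [MeasurableSpace Ω] {P : Measure Ω}
    [IsFiniteMeasure P] {T : Ω → Ω} (hT : MeasurePreserving T P P) (ψ : SimpleFunc Ω M) :
    ∀ᵐ ω ∂P, Tendsto (fun p : ℕ × ℕ =>
      wasserstein1 (empiricalMeasure T ψ p.1 ω) (empiricalMeasure T ψ p.2 ω))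
      (atTop ×ˢ atTop) (𝓝 0) :=
  ((Finset.eventually_all ψ.range).2 fun x _ =>
    ae_exists_tendsto_visitFrequency hT (ψ.measurableSet_fiber x)).mono fun _ h =>
      tendsto_wasserstein1_empiricalMeasure_simpleFunc h

end EmpiricalMeasureMetric

/-! ### Contractive barycentric maps along an orbit -/

section ContractiveDist

variable {M : Type*} [MetricSpace M] [MeasurableSpace M] {α : Measure M → M}

/-- The largest distance between the images of two measures under contractive barycentric maps. It
is dominated by `wasserstein1` on `𝒫¹(M)`, and its triangle inequality needs no gluing of
couplings. -/
noncomputable def contractiveDist (μ ν : Measure M) : ℝ≥0∞ :=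
  ⨆ (α : Measure M → M) (_ : IsContractiveBarycentricMap α), edist (α μ) (α ν)

lemma IsContractiveBarycentricMap.edist_le_contractiveDist (hα : IsContractiveBarycentricMap α)
    (μ ν : Measure M) : edist (α μ) (α ν) ≤ contractiveDist μ ν :=
  le_iSup₂ (f := fun (α : Measure M → M) (_ : IsContractiveBarycentricMap α) =>
    edist (α μ) (α ν)) α hα

lemma contractiveDist_le_wasserstein1 {μ ν : Measure M} (hμ : μ ∈ P1 M) (hν : ν ∈ P1 M) :
    contractiveDist μ ν ≤ wasserstein1 μ ν :=
  iSup₂_le fun _ hα => hα.2 _ hμ _ hν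

lemma contractiveDist_comm (μ ν : Measure M) : contractiveDist μ ν = contractiveDist ν μ := by
  simp only [contractiveDist, edist_comm]

lemma contractiveDist_triangle (μ ν ρ : Measure M) :
    contractiveDist μ ρ ≤ contractiveDist μ ν + contractiveDist ν ρ :=
  iSup₂_le fun α hα => (edist_triangle (α μ) (α ν) (α ρ)).trans
    (add_le_add (hα.edist_le_contractiveDist μ ν) (hα.edist_le_contractiveDist ν ρ))

/-- The empirical measures along the orbit of `ω` form a Cauchy sequence, uniformly with respect to
all contractive barycentric maps. -/
def IsCauchyOrbit {Ω : Type*} (T : Ω → Ω) (φ : Ω → M) (ω : Ω) : Prop :=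
  ∀ ε > 0, ∃ N, ∀ m ≥ N, ∀ n ≥ N,
    contractiveDist (empiricalMeasure T φ m ω) (empiricalMeasure T φ n ω) ≤ ε

lemma IsContractiveBarycentricMap.tendsto_ergodicLimit [Nonempty M] [CompleteSpace M]
    {Ω : Type*} {T : Ω → Ω} {φ : Ω → M} {ω : Ω} (hα : IsContractiveBarycentricMap α)
    (h : IsCauchyOrbit T φ ω) :
    Tendsto (fun n => α (empiricalMeasure T φ n ω)) atTop (𝓝 (ergodicLimit T α φ ω)) := by
  refine CauchySeq.tendsto_limUnder (EMetric.cauchySeq_iff.2 fun ε hε => ?_)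
  obtain ⟨δ, hδ, hδε⟩ := exists_between hε
  obtain ⟨N, hN⟩ := h δ hδ
  exact ⟨N, fun m hm n hn =>
    (hα.edist_le_contractiveDist _ _).trans_lt ((hN m hm n hn).trans_lt hδε)⟩

lemma IsContractiveBarycentricMap.ergodicLimit_const [Nonempty M] {Ω : Type*}
    (hα : IsContractiveBarycentricMap α) (T : Ω → Ω) (x : M) :
    ergodicLimit T α (fun _ => x) = fun _ => x := by
  funext ω
  refine (tendsto_const_nhds.congr' ?_).limUnder_eq
  filter_upwards [eventually_ne_atTop 0] with n hn
  rw [empiricalMeasure_const T x hn, hα.1]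

variable [BorelSpace M] {Ω : Type*} {T : Ω → Ω} {φ : Ω → M} {ω : Ω}

lemma IsContractiveBarycentricMap.edist_empiricalMeasure_le (hα : IsContractiveBarycentricMap α)
    (T : Ω → Ω) (φ ψ : Ω → M) (n : ℕ) (ω : Ω) :
    edist (α (empiricalMeasure T φ n ω)) (α (empiricalMeasure T ψ n ω)) ≤
      birkhoffAverage NNReal T (fun ω => edist (φ ω) (ψ ω)) n ω := by
  rcases eq_or_ne n 0 with rfl | hn
  · simp [empiricalMeasure]
  · refine (hα.2 _ (empiricalMeasure_mem_P1 T φ hn ω) _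
      (empiricalMeasure_mem_P1 T ψ hn ω)).trans ?_
    rw [empiricalMeasure_eq_map, empiricalMeasure_eq_map, birkhoffAverage_ennreal]
    refine (wasserstein1_map_map_le (measurable_of_countable _).aemeasurable
      (measurable_of_countable _).aemeasurable).trans_eq ?_
    rw [distL1, lintegral_uniformOn_univ, Fintype.card_fin,
      Fin.sum_univ_eq_sum_range fun k => edist (φ (T^[k] ω)) (ψ (T^[k] ω))]

lemma contractiveDist_empiricalMeasure_le (T : Ω → Ω) (φ ψ : Ω → M) (n : ℕ) (ω : Ω) :
    contractiveDist (empiricalMeasure T φ n ω) (empiricalMeasure T ψ n ω) ≤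
      birkhoffAverage NNReal T (fun ω => edist (φ ω) (ψ ω)) n ω :=
  iSup₂_le fun _ hα => hα.edist_empiricalMeasure_le T φ ψ n ω

lemma IsContractiveBarycentricMap.edist_empiricalMeasure_le_of_forall
    (hα : IsContractiveBarycentricMap α) {x : M} {C : ℝ≥0∞} (hφ : ∀ ω, edist x (φ ω) ≤ C)
    {n : ℕ} (hn : n ≠ 0) (ω : Ω) : edist x (α (empiricalMeasure T φ n ω)) ≤ C := by
  have h := hα.edist_empiricalMeasure_le T (fun _ => x) φ n ω
  rw [empiricalMeasure_const T x hn, hα.1] at h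
  exact h.trans (birkhoffAverage_le_of_le hφ n ω)

lemma isCauchyOrbit_of_approx (h : ∀ ε > 0, ∃ ψ : Ω → M,
    (∀ n, birkhoffAverage NNReal T (fun ω => edist (φ ω) (ψ ω)) n ω ≤ ε) ∧
    Tendsto (fun p : ℕ × ℕ =>
      wasserstein1 (empiricalMeasure T ψ p.1 ω) (empiricalMeasure T ψ p.2 ω))
      (atTop ×ˢ atTop) (𝓝 0)) : IsCauchyOrbit T φ ω := by
  intro ε hε
  have hε3 : 0 < ε / 3 := ENNReal.div_pos hε.ne' (by simp)
  obtain ⟨ψ, hφψ, hψ⟩ := h (ε / 3) hε3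
  have hsmall := (ENNReal.tendsto_nhds_zero.1 hψ _ hε3).and
    ((eventually_ne_atTop 0).prod_mk (eventually_ne_atTop 0))
  rw [prod_atTop_atTop_eq, eventually_atTop_prod_self] at hsmall
  obtain ⟨N, hN⟩ := hsmall
  refine ⟨N, fun m hm n hn => ?_⟩
  obtain ⟨hmn, hm0, hn0⟩ := hN m n hm hn
  have happrox (k : ℕ) := (contractiveDist_empiricalMeasure_le T φ ψ k ω).trans (hφψ k)
  calc contractiveDist (empiricalMeasure T φ m ω) (empiricalMeasure T φ n ω)
      ≤ contractiveDist (empiricalMeasure T φ m ω) (empiricalMeasure T ψ m ω) +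
          contractiveDist (empiricalMeasure T ψ m ω) (empiricalMeasure T ψ n ω) +
          contractiveDist (empiricalMeasure T ψ n ω) (empiricalMeasure T φ n ω) :=
        (contractiveDist_triangle _ _ _).trans
          (add_le_add (contractiveDist_triangle _ _ _) le_rfl)
    _ ≤ ε / 3 + ε / 3 + ε / 3 := by
        gcongr
        · exact happrox m
        · exact (contractiveDist_le_wasserstein1 (empiricalMeasure_mem_P1 T ψ hm0 ω)
            (empiricalMeasure_mem_P1 T ψ hn0 ω)).trans hmn
        · exact (contractiveDist_comm _ _).trans_le (happrox n)
    _ = ε := ENNReal.add_thirds ε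

end ContractiveDist

/-! ### Cauchy orbits -/

section CauchyOrbit

variable {M : Type*} [MetricSpace M] {Ω : Type*} [MeasurableSpace Ω] {P : Measure Ω}
  [IsFiniteMeasure P] {T : Ω → Ω} {φ : Ω → M}

lemma measure_exists_lt_birkhoffAverage_le (hT : MeasurePreserving T P P) {f : Ω → NNReal}
    (hf : Measurable f) {c : NNReal} (hc : 0 < c) :
    P {ω | ∃ n, (c : ℝ≥0∞) < birkhoffAverage NNReal T (fun ω => (f ω : ℝ≥0∞)) n ω} ≤
      (∫⁻ ω, f ω ∂P) / c := by
  rcases eq_or_ne (∫⁻ ω, f ω ∂P) ∞ with hfin | hfin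
  · simp [hfin, ENNReal.top_div_of_ne_top]
  set g : Ω → ℝ := fun ω => f ω
  have hg0 : 0 ≤ g := fun ω => (f ω).2
  have hgm : Measurable g := hf.coe_nnreal_real
  have hg : Integrable g P := by
    refine ⟨hgm.aestronglyMeasurable, ?_⟩
    rw [hasFiniteIntegral_iff_ofReal (.of_forall hg0)]
    simpa [g] using hfin.lt_top
  have hsubset : {ω | ∃ n, (c : ℝ≥0∞) < birkhoffAverage NNReal T (fun ω => (f ω : ℝ≥0∞)) n ω} ⊆
      {ω | ∃ n : ℕ, n * (c : ℝ) < birkhoffSum T g n ω} := by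
    rintro ω ⟨n, hn⟩
    have havg := ofReal_birkhoffAverage T hg0 n ω
    simp only [g, ENNReal.ofReal_coe_nnreal] at havg
    rw [← havg, ENNReal.lt_ofReal_iff_toReal_lt ENNReal.coe_ne_top, ENNReal.coe_toReal] at hn
    rcases Nat.eq_zero_or_pos n with rfl | hn0
    · simp only [birkhoffAverage_zero] at hn
      exact absurd hn hc.not_gt
    · refine ⟨n, ?_⟩
      rwa [birkhoffAverage, smul_eq_mul, lt_inv_mul_iff₀ (Nat.cast_pos.2 hn0)] at hn
  refine (measure_mono hsubset).trans
    ((measure_exists_lt_birkhoffSum_le hT hgm hg hg0 hc).trans_eq ?_)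
  rw [ENNReal.ofReal_div_of_pos hc, ofReal_integral_eq_lintegral_ofReal hg (.of_forall hg0)]
  simp [g]

variable [MeasurableSpace M] [BorelSpace M]

/-- Approximating `φ` up to `δ j ^ 2` in `L¹` makes the exceptional sets of the maximal inequality
summable, so that Borel–Cantelli applies. -/
lemma exists_simpleFunc_ae_eventually_birkhoffAverage_le (hT : MeasurePreserving T P P)
    (hφm : StronglyMeasurable φ) (hφ : MemL1 P φ) {δ : ℕ → NNReal} (hδ : ∀ j, 0 < δ j)
    (hsum : Summable δ) : ∃ ψ : ℕ → SimpleFunc Ω M, ∀ᵐ ω ∂P, ∀ᶠ j in atTop, ∀ n,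
      birkhoffAverage NNReal T (fun ω => edist (φ ω) (ψ j ω)) n ω ≤ δ j := by
  choose ψ hψ using fun j =>
    hφ.exists_simpleFunc_distL1_le (ENNReal.coe_pos.2 (mul_pos (hδ j) (hδ j)))
  refine ⟨ψ, ?_⟩
  have hmeas (j : ℕ) : P {ω | ∃ n, (δ j : ℝ≥0∞) <
      birkhoffAverage NNReal T (fun ω => edist (φ ω) (ψ j ω)) n ω} ≤ δ j := by
    simp only [edist_nndist]
    refine (measure_exists_lt_birkhoffAverage_le hT
      (continuous_nndist.comp_stronglyMeasurable
        (hφm.prodMk (ψ j).stronglyMeasurable)).measurable (hδ j)).trans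
          (ENNReal.div_le_of_le_mul ?_)
    simpa only [distL1, edist_nndist, ENNReal.coe_mul] using hψ j
  have hsum' := ne_top_of_le_ne_top (ENNReal.tsum_coe_ne_top_iff_summable.2 hsum)
    (ENNReal.tsum_le_tsum hmeas)
  filter_upwards [ae_eventually_notMem hsum'] with ω hω
  filter_upwards [hω] with j hj n using not_lt.1 fun h => hj ⟨n, h⟩

lemma ae_isCauchyOrbit_of_stronglyMeasurable (hT : MeasurePreserving T P P)
    (hφm : StronglyMeasurable φ) (hφ : MemL1 P φ) : ∀ᵐ ω ∂P, IsCauchyOrbit T φ ω := by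
  obtain ⟨δ, hδ0, _, hsum, -⟩ := NNReal.exists_pos_sum_of_countable one_ne_zero ℕ
  obtain ⟨ψ, hψ⟩ := exists_simpleFunc_ae_eventually_birkhoffAverage_le hT hφm hφ hδ0 hsum.summable
  have hsimple := ae_all_iff.2 fun j =>
    ae_tendsto_wasserstein1_empiricalMeasure_simpleFunc hT (ψ j)
  have hδ : Tendsto (fun j => (δ j : ℝ≥0∞)) atTop (𝓝 0) :=
    ENNReal.tendsto_coe.2 (NNReal.tendsto_atTop_zero_of_summable hsum.summable)
  filter_upwards [hψ, hsimple] with ω hφψ hψω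
  refine isCauchyOrbit_of_approx fun ε hε => ?_
  obtain ⟨j, hj, hjε⟩ := (hφψ.and (ENNReal.tendsto_nhds_zero.1 hδ ε hε)).exists
  exact ⟨ψ j, fun n => (hj n).trans hjε, hψω j⟩

theorem ae_isCauchyOrbit (hT : MeasurePreserving T P P) (hφ : MemL1 P φ) :
    ∀ᵐ ω ∂P, IsCauchyOrbit T φ ω := by
  obtain ⟨hφm, x, hx⟩ := hφ
  have hmk : MemL1 P (hφm.mk φ) := ⟨hφm.stronglyMeasurable_mk.aestronglyMeasurable, x,
    (lintegral_congr_ae (hφm.ae_eq_mk.fun_comp (edist x))).symm.trans_lt hx⟩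
  have horbit : ∀ᵐ ω ∂P, ∀ k, φ (T^[k] ω) = hφm.mk φ (T^[k] ω) :=
    ae_all_iff.2 fun k => (hT.iterate k).quasiMeasurePreserving.ae hφm.ae_eq_mk
  filter_upwards [horbit, ae_isCauchyOrbit_of_stronglyMeasurable hT hφm.stronglyMeasurable_mk hmk]
    with ω h hω
  simpa only [IsCauchyOrbit, empiricalMeasure, h] using hω

end CauchyOrbit

/-! ### Contractions of `L¹` -/

section L1Contraction

variable {M : Type*} [MetricSpace M] {Ω : Type*} [MeasurableSpace Ω] {P : Measure Ω}
  {φ ψ : Ω → M}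

lemma distL1_le_of_tendsto_ae {u v : ℕ → Ω → M} {C : ℝ≥0∞}
    (hu : ∀ n, AEStronglyMeasurable (u n) P) (hv : ∀ n, AEStronglyMeasurable (v n) P)
    (huφ : ∀ᵐ ω ∂P, Tendsto (fun n => u n ω) atTop (𝓝 (φ ω)))
    (hvψ : ∀ᵐ ω ∂P, Tendsto (fun n => v n ω) atTop (𝓝 (ψ ω)))
    (hC : ∀ᶠ n in atTop, distL1 P (u n) (v n) ≤ C) : distL1 P φ ψ ≤ C := by
  calc distL1 P φ ψ = ∫⁻ ω, liminf (fun n => edist (u n ω) (v n ω)) atTop ∂P := by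
        refine lintegral_congr_ae ?_
        filter_upwards [huφ, hvψ] with ω hφω hψω using (hφω.edist hψω).liminf_eq.symm
    _ ≤ liminf (fun n => distL1 P (u n) (v n)) atTop :=
        lintegral_liminf_le' fun n => (hu n).edist (hv n)
    _ ≤ C := liminf_le_of_frequently_le' hC.frequently

lemma tendsto_distL1_of_edist_le [IsFiniteMeasure P] {ι : Type*} {l : Filter ι}
    [l.IsCountablyGenerated] {u : ι → Ω → M} {v : Ω → M} {x : M} {C : ℝ≥0∞} (hC : C ≠ ∞)
    (hu : ∀ᶠ i in l, AEStronglyMeasurable (u i) P) (hv : AEStronglyMeasurable v P)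
    (huC : ∀ᶠ i in l, ∀ᵐ ω ∂P, edist x (u i ω) ≤ C) (hvC : ∀ᵐ ω ∂P, edist x (v ω) ≤ C)
    (hlim : ∀ᵐ ω ∂P, Tendsto (fun i => u i ω) l (𝓝 (v ω))) :
    Tendsto (fun i => distL1 P (u i) v) l (𝓝 0) := by
  rw [← lintegral_zero (μ := P)]
  refine tendsto_lintegral_filter_of_dominated_convergence' (fun _ => C + C)
    (hu.mono fun i hi => hi.edist hv) ?_ ?_
    (hlim.mono fun ω hω => tendsto_iff_edist_tendsto_0.1 hω)
  · filter_upwards [huC] with i hi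
    filter_upwards [hi, hvC] with ω hiω hvω
    exact (edist_triangle_left _ _ x).trans (add_le_add hiω hvω)
  · rw [lintegral_const]
    exact ENNReal.mul_ne_top (ENNReal.add_ne_top.2 ⟨hC, hC⟩) (measure_ne_top _ _)

/-- `F` maps integrable functions to measurable ones, without increasing their `L¹`-distance;
the integrability of `F φ` is not part of the notion. -/
def IsL1Contraction (P : Measure Ω) (F : (Ω → M) → Ω → M) : Prop :=
  ∀ φ, MemL1 P φ → AEStronglyMeasurable (F φ) P ∧
    ∀ ψ, MemL1 P ψ → distL1 P (F φ) (F ψ) ≤ distL1 P φ ψ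

lemma IsL1Contraction.tendsto_distL1_of_simpleFunc [MeasurableSpace M] [BorelSpace M]
    [IsFiniteMeasure P] {ι : Type*} {l : Filter ι} {F : ι → (Ω → M) → Ω → M}
    {G : (Ω → M) → Ω → M} (hG : IsL1Contraction P G) (hF : ∀ᶠ i in l, IsL1Contraction P (F i))
    (hFG : ∀ ψ : SimpleFunc Ω M, Tendsto (fun i => distL1 P (F i ψ) (G ψ)) l (𝓝 0))
    (hφ : MemL1 P φ) : Tendsto (fun i => distL1 P (F i φ) (G φ)) l (𝓝 0) := by
  rw [ENNReal.tendsto_nhds_zero]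
  intro ε hε
  have hε3 : 0 < ε / 3 := ENNReal.div_pos hε.ne' (by simp)
  obtain ⟨ψ, hφψ⟩ := hφ.exists_simpleFunc_distL1_le hε3
  have hψ : MemL1 P ψ := memL1_simpleFunc hφ.2.choose ψ
  filter_upwards [hF, ENNReal.tendsto_nhds_zero.1 (hFG ψ) _ hε3] with i hi hiψ
  calc distL1 P (F i φ) (G φ)
      ≤ distL1 P (F i φ) (F i ψ) + (distL1 P (F i ψ) (G ψ) + distL1 P (G ψ) (G φ)) :=
        (distL1_triangle (hi φ hφ).1 (hi ψ hψ).1).trans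
          (add_le_add le_rfl (distL1_triangle (hi ψ hψ).1 (hG ψ hψ).1))
    _ ≤ ε / 3 + (ε / 3 + ε / 3) := by
        gcongr
        · exact ((hi φ hφ).2 ψ hψ).trans hφψ
        · exact ((hG ψ hψ).2 φ hφ).trans ((distL1_comm P _ _).trans_le hφψ)
    _ = ε := by rw [← add_assoc, ENNReal.add_thirds]

end L1Contraction

/-! ### Ergodic limits -/

section ErgodicLimit

variable {M : Type*} [MetricSpace M] [MeasurableSpace M] [BorelSpace M]
  {α : Measure M → M}

lemma IsContractiveBarycentricMap.lipschitzWith_map_uniformOn_univ {ι : Type*} [Fintype ι]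
    [Nonempty ι] [MeasurableSpace ι] [MeasurableSingletonClass ι]
    (hα : IsContractiveBarycentricMap α) :
    LipschitzWith 1 fun v : ι → M => α ((ProbabilityTheory.uniformOn univ).map v) := by
  intro v w
  have := ProbabilityTheory.isProbabilityMeasure_uniformOn (finite_univ (α := ι)) univ_nonempty
  calc edist (α ((ProbabilityTheory.uniformOn univ).map v))
        (α ((ProbabilityTheory.uniformOn univ).map w))
      ≤ distL1 (ProbabilityTheory.uniformOn univ) v w :=
        (hα.2 _ (map_uniformOn_univ_mem_P1 v) _ (map_uniformOn_univ_mem_P1 w)).trans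
          (wasserstein1_map_map_le (measurable_of_countable v).aemeasurable
            (measurable_of_countable w).aemeasurable)
    _ ≤ ∫⁻ _, edist v w ∂ProbabilityTheory.uniformOn (univ : Set ι) :=
        lintegral_mono fun i => edist_le_pi_edist v w i
    _ = (1 : NNReal) * edist v w := by simp

variable {Ω : Type*} {T : Ω → Ω} {φ : Ω → M} {ω : Ω}

theorem tendsto_ergodicLimit_of_tendsto [Nonempty M] [CompleteSpace M] {ι : Type*} {l : Filter ι}
    {κ : ι → Measure M → M} (hκ : ∀ᶠ i in l, IsContractiveBarycentricMap (κ i))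
    (hα : IsContractiveBarycentricMap α) (hlim : ∀ μ ∈ P1 M, Tendsto (fun i => κ i μ) l (𝓝 (α μ)))
    (hω : IsCauchyOrbit T φ ω) :
    Tendsto (fun i => ergodicLimit T (κ i) φ ω) l (𝓝 (ergodicLimit T α φ ω)) := by
  rw [tendsto_iff_edist_tendsto_0, ENNReal.tendsto_nhds_zero]
  intro ε hε
  have hε3 : 0 < ε / 3 := ENNReal.div_pos hε.ne' (by simp)
  obtain ⟨N, hN⟩ := hω (ε / 3) hε3
  set ν := empiricalMeasure T φ (N + 1) ω
  have hclose {α : Measure M → M} (hα : IsContractiveBarycentricMap α) :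
      edist (α ν) (ergodicLimit T α φ ω) ≤ ε / 3 :=
    le_of_tendsto (tendsto_const_nhds.edist (hα.tendsto_ergodicLimit hω)) <|
      (eventually_ge_atTop N).mono fun n hn =>
        (hα.edist_le_contractiveDist _ _).trans (hN _ N.le_succ n hn)
  have hν := tendsto_iff_edist_tendsto_0.1 (hlim ν (empiricalMeasure_mem_P1 T φ N.succ_ne_zero ω))
  filter_upwards [hκ, ENNReal.tendsto_nhds_zero.1 hν _ hε3] with i hi hiν
  calc edist (ergodicLimit T (κ i) φ ω) (ergodicLimit T α φ ω)
      ≤ edist (ergodicLimit T (κ i) φ ω) (κ i ν) + edist (κ i ν) (α ν) +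
          edist (α ν) (ergodicLimit T α φ ω) := edist_triangle4 _ _ _ _
    _ ≤ ε / 3 + ε / 3 + ε / 3 := by
        gcongr
        · exact (edist_comm _ _).trans_le (hclose hi)
        · exact hclose hα
    _ = ε := ENNReal.add_thirds ε

variable [MeasurableSpace Ω] {P : Measure Ω}

namespace IsContractiveBarycentricMap

lemma aestronglyMeasurable_empiricalMeasure (hα : IsContractiveBarycentricMap α)
    (hT : MeasurePreserving T P P) (hφ : AEStronglyMeasurable φ P) (n : ℕ) :
    AEStronglyMeasurable (fun ω => α (empiricalMeasure T φ n ω)) P := by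
  rcases eq_or_ne n 0 with rfl | hn
  · simp only [empiricalMeasure, Finset.range_zero, Finset.sum_empty, smul_zero]
    exact aestronglyMeasurable_const
  · have : NeZero n := ⟨hn⟩
    simp only [empiricalMeasure_eq_map]
    exact hα.lipschitzWith_map_uniformOn_univ.continuous.comp_aestronglyMeasurable <|
      aestronglyMeasurable_pi fun k : Fin n => hφ.comp_measurePreserving (hT.iterate k)

lemma isL1Contraction_empiricalMeasure (hα : IsContractiveBarycentricMap α)
    (hT : MeasurePreserving T P P) (n : ℕ) :
    IsL1Contraction P fun φ ω => α (empiricalMeasure T φ n ω) := fun φ hφ =>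
  ⟨hα.aestronglyMeasurable_empiricalMeasure hT hφ.1 n, fun ψ hψ =>
    (lintegral_mono fun ω => hα.edist_empiricalMeasure_le T φ ψ n ω).trans
      (lintegral_birkhoffAverage_le hT (hφ.1.edist hψ.1) n)⟩

variable [Nonempty M] [CompleteSpace M] [IsFiniteMeasure P]

lemma ae_tendsto_ergodicLimit (hα : IsContractiveBarycentricMap α)
    (hT : MeasurePreserving T P P) (hφ : MemL1 P φ) : ∀ᵐ ω ∂P,
      Tendsto (fun n => α (empiricalMeasure T φ n ω)) atTop (𝓝 (ergodicLimit T α φ ω)) :=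
  (ae_isCauchyOrbit hT hφ).mono fun _ hω => hα.tendsto_ergodicLimit hω

lemma isL1Contraction_ergodicLimit (hα : IsContractiveBarycentricMap α)
    (hT : MeasurePreserving T P P) : IsL1Contraction P (ergodicLimit T α) := by
  have hmeas (φ : Ω → M) (hφ : MemL1 P φ) (n : ℕ) :=
    (hα.isL1Contraction_empiricalMeasure hT n φ hφ).1
  refine fun φ hφ => ⟨aestronglyMeasurable_of_tendsto_ae atTop (hmeas φ hφ)
    (hα.ae_tendsto_ergodicLimit hT hφ), fun ψ hψ => ?_⟩
  exact distL1_le_of_tendsto_ae (hmeas φ hφ) (hmeas ψ hψ) (hα.ae_tendsto_ergodicLimit hT hφ)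
    (hα.ae_tendsto_ergodicLimit hT hψ)
    (.of_forall fun n => (hα.isL1Contraction_empiricalMeasure hT n φ hφ).2 ψ hψ)

lemma memL1_ergodicLimit (hα : IsContractiveBarycentricMap α) (hT : MeasurePreserving T P P)
    (hφ : MemL1 P φ) : MemL1 P (ergodicLimit T α φ) := by
  obtain ⟨x, hx⟩ := hφ.2
  have hconst : MemL1 P fun _ : Ω => x := memL1_simpleFunc x (SimpleFunc.const Ω x)
  have hle := (hα.isL1Contraction_ergodicLimit hT _ hconst).2 φ hφ
  rw [hα.ergodicLimit_const T x] at hle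
  exact ⟨(hα.isL1Contraction_ergodicLimit hT φ hφ).1, x, hle.trans_lt hx⟩

lemma ae_edist_ergodicLimit_le (hα : IsContractiveBarycentricMap α)
    (hT : MeasurePreserving T P P) (hφ : MemL1 P φ) {x : M} {C : ℝ≥0∞}
    (hφC : ∀ ω, edist x (φ ω) ≤ C) : ∀ᵐ ω ∂P, edist x (ergodicLimit T α φ ω) ≤ C :=
  (hα.ae_tendsto_ergodicLimit hT hφ).mono fun ω hω =>
    le_of_tendsto (tendsto_const_nhds.edist hω) <| (eventually_ne_atTop 0).mono fun _ hn =>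
      hα.edist_empiricalMeasure_le_of_forall hφC hn ω

theorem tendsto_distL1_ergodicLimit (hα : IsContractiveBarycentricMap α)
    (hT : MeasurePreserving T P P) (hφ : MemL1 P φ) :
    Tendsto (fun n => distL1 P (fun ω => α (empiricalMeasure T φ n ω)) (ergodicLimit T α φ))
      atTop (𝓝 0) := by
  refine (hα.isL1Contraction_ergodicLimit hT).tendsto_distL1_of_simpleFunc
    (F := fun n φ ω => α (empiricalMeasure T φ n ω))
    (.of_forall (hα.isL1Contraction_empiricalMeasure hT)) (fun ψ => ?_) hφ
  obtain ⟨x⟩ := ‹Nonempty M›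
  have hψ : MemL1 P ψ := memL1_simpleFunc x ψ
  have hψC := edist_simpleFunc_le ψ x
  refine tendsto_distL1_of_edist_le (ENNReal.sum_ne_top.2 fun _ _ => edist_ne_top x _)
    (.of_forall fun n => (hα.isL1Contraction_empiricalMeasure hT n ψ hψ).1)
    (hα.isL1Contraction_ergodicLimit hT ψ hψ).1 ?_ (hα.ae_edist_ergodicLimit_le hT hψ hψC)
    (hα.ae_tendsto_ergodicLimit hT hψ)
  filter_upwards [eventually_ne_atTop 0] with n hn
  exact .of_forall (hα.edist_empiricalMeasure_le_of_forall hψC hn)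

theorem isErgodicLimit (hα : IsContractiveBarycentricMap α) (hT : MeasurePreserving T P P)
    (hφ : MemL1 P φ) : IsErgodicLimit P T α φ (ergodicLimit T α φ) :=
  ⟨hα.memL1_ergodicLimit hT hφ, hα.ae_tendsto_ergodicLimit hT hφ,
    hα.tendsto_distL1_ergodicLimit hT hφ⟩

end IsContractiveBarycentricMap

theorem tendsto_distL1_ergodicLimit_of_tendsto [Nonempty M] [CompleteSpace M] [IsFiniteMeasure P]
    {ι : Type*} {l : Filter ι} [l.IsCountablyGenerated] {κ : ι → Measure M → M}
    (hκ : ∀ᶠ i in l, IsContractiveBarycentricMap (κ i)) (hα : IsContractiveBarycentricMap α)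
    (hlim : ∀ μ ∈ P1 M, Tendsto (fun i => κ i μ) l (𝓝 (α μ))) (hT : MeasurePreserving T P P)
    (hφ : MemL1 P φ) :
    Tendsto (fun i => distL1 P (ergodicLimit T (κ i) φ) (ergodicLimit T α φ)) l (𝓝 0) := by
  refine (hα.isL1Contraction_ergodicLimit hT).tendsto_distL1_of_simpleFunc
    (hκ.mono fun i hi => hi.isL1Contraction_ergodicLimit hT) (fun ψ => ?_) hφ
  obtain ⟨x⟩ := ‹Nonempty M›
  have hψ : MemL1 P ψ := memL1_simpleFunc x ψ
  have hψC := edist_simpleFunc_le ψ x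
  refine tendsto_distL1_of_edist_le (ENNReal.sum_ne_top.2 fun _ _ => edist_ne_top x _)
    (hκ.mono fun i hi => (hi.isL1Contraction_ergodicLimit hT ψ hψ).1)
    (hα.isL1Contraction_ergodicLimit hT ψ hψ).1
    (hκ.mono fun i hi => hi.ae_edist_ergodicLimit_le hT hψ hψC)
    (hα.ae_edist_ergodicLimit_le hT hψ hψC) ?_
  exact (ae_isCauchyOrbit hT hψ).mono fun ω hω => tendsto_ergodicLimit_of_tendsto hκ hα hlim hω

end ErgodicLimit

theorem corollary5p7_general {M : Type*} [MetricSpace M] [MeasurableSpace M] [BorelSpace M]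
    [Nonempty M] (hM : IsGlobalNPC M)
    {Ω : Type*} [MeasurableSpace Ω] (P : Measure Ω) [IsProbabilityMeasure P]
    (T : Ω → Ω) (hT : MeasurePreserving T P P)
    (β : Measure M → M) (hβ : IsContractiveBarycentricMap β) :
    ((∀ (x y : M) (γ : ℝ → M),
        IsMinimalGeodesic x y γ ↔ EqOn γ (geodesicPoint x y) (Icc 0 1)) ∧
      (IsContractiveBarycentricMap (canonicalBarycenter : Measure M → M) ∧
        ∀ μ ∈ P1 M, ∀ z : M, z = canonicalBarycenter μ ↔ IsCanonicalBarycenter μ z) ∧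
      (∀ t ∈ Ioc (0 : ℝ) 1, IsContractiveBarycentricMap (barycenterFlow t β) ∧
        ∀ μ ∈ P1 M, ∀ x : M, x = barycenterFlow t β μ ↔ x = β (geodesicPush x t μ))) ∧
    ∀ φ : Ω → M, MemL1 P φ →
      (IsErgodicLimit P T canonicalBarycenter φ (ergodicLimit T canonicalBarycenter φ) ∧
        (∀ t ∈ Ioc (0 : ℝ) 1,
          IsErgodicLimit P T (barycenterFlow t β) φ (ergodicLimit T (barycenterFlow t β) φ)) ∧
        ∀ᵐ ω ∂P, ∀ t ∈ Ioc (0 : ℝ) 1,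
          Tendsto (fun n : ℕ => barycenterFlow t β (empiricalMeasure T φ n ω)) atTop
            (𝓝 (ergodicLimit T (barycenterFlow t β) φ ω))) ∧
      Tendsto (fun t : ℝ => distL1 P (ergodicLimit T (barycenterFlow t β) φ)
          (ergodicLimit T canonicalBarycenter φ)) (𝓝[>] 0) (𝓝 0) ∧
      (∀ᵐ ω ∂P, Tendsto (fun t : ℝ => ergodicLimit T (barycenterFlow t β) φ ω) (𝓝[>] 0)
          (𝓝 (ergodicLimit T canonicalBarycenter φ ω))) ∧
      Tendsto (fun t : ℝ => barycentricExpectation P (barycenterFlow t β) φ) (𝓝[>] 0)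
        (𝓝 (barycentricExpectation P canonicalBarycenter φ)) := by
  have := hM.complete
  have hcan := hM.isContractiveBarycentricMap_canonicalBarycenter
  have hflow : ∀ t ∈ Ioc (0 : ℝ) 1, IsContractiveBarycentricMap (barycenterFlow t β) :=
    fun t ht => hM.isContractiveBarycentricMap_barycenterFlow hβ ht
  have hev : ∀ᶠ t in 𝓝[>] (0 : ℝ), IsContractiveBarycentricMap (barycenterFlow t β) :=
    mem_of_superset (Ioc_mem_nhdsGT one_pos) hflow
  have hlim : ∀ μ ∈ P1 M, Tendsto (fun t : ℝ => barycenterFlow t β μ) (𝓝[>] 0)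
      (𝓝 (canonicalBarycenter μ)) := fun μ hμ => hM.tendsto_barycenterFlow hβ hμ
  refine ⟨⟨hM.isMinimalGeodesic_iff, ⟨hcan, fun μ hμ z => hM.eq_canonicalBarycenter_iff hμ z⟩,
    fun t ht => ⟨hflow t ht, fun μ hμ x => hM.eq_barycenterFlow_iff hβ ht hμ x⟩⟩,
    fun φ hφ => ?_⟩
  refine ⟨⟨hcan.isErgodicLimit hT hφ, fun t ht => (hflow t ht).isErgodicLimit hT hφ, ?_⟩,
    tendsto_distL1_ergodicLimit_of_tendsto hev hcan hlim hT hφ, ?_, hlim _ hφ.map_mem_P1⟩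
  · filter_upwards [ae_isCauchyOrbit hT hφ] with ω hω t ht using
      (hflow t ht).tendsto_ergodicLimit hω
  · filter_upwards [ae_isCauchyOrbit hT hφ] with ω hω using
      tendsto_ergodicLimit_of_tendsto hev hcan hlim hω

theorem corollary5p7 {M : Type*} [MetricSpace M] [MeasurableSpace M] [BorelSpace M] [Nonempty M]
    (hM : IsGlobalNPC M)
    {Ω : Type*} [MeasurableSpace Ω] (P : Measure Ω) [IsProbabilityMeasure P]
    (T : Ω → Ω) (hT : MeasurePreserving T P P)
    (β : Measure M → M) (hβ : IsContractiveBarycentricMap β) :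
    -- the objects in the claim are well defined: the geodesics, the map `λ`, the maps `β_t`
    ((∀ (x y : M) (γ : ℝ → M),
        IsMinimalGeodesic x y γ ↔ EqOn γ (geodesicPoint x y) (Icc 0 1)) ∧
      (IsContractiveBarycentricMap (canonicalBarycenter : Measure M → M) ∧
        ∀ μ ∈ P1 M, ∀ z : M, z = canonicalBarycenter μ ↔ IsCanonicalBarycenter μ z) ∧
      (∀ t ∈ Ioc (0 : ℝ) 1, IsContractiveBarycentricMap (barycenterFlow t β) ∧
        ∀ μ ∈ P1 M, ∀ x : M, x = barycenterFlow t β μ ↔ x = β (geodesicPush x t μ))) ∧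
    ∀ φ : Ω → M, MemL1 P φ →
      -- the ergodic limit functions exist, pointwise off one null set common to all `t`
      (IsErgodicLimit P T canonicalBarycenter φ (ergodicLimit T canonicalBarycenter φ) ∧
        (∀ t ∈ Ioc (0 : ℝ) 1,
          IsErgodicLimit P T (barycenterFlow t β) φ (ergodicLimit T (barycenterFlow t β) φ)) ∧
        ∀ᵐ ω ∂P, ∀ t ∈ Ioc (0 : ℝ) 1,
          Tendsto (fun n : ℕ => barycenterFlow t β (empiricalMeasure T φ n ω)) atTop
            (𝓝 (ergodicLimit T (barycenterFlow t β) φ ω))) ∧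
      -- convergence in `L¹` as `t → 0⁺`
      Tendsto (fun t : ℝ => distL1 P (ergodicLimit T (barycenterFlow t β) φ)
          (ergodicLimit T canonicalBarycenter φ)) (𝓝[>] 0) (𝓝 0) ∧
      -- convergence almost everywhere as `t → 0⁺`
      (∀ᵐ ω ∂P, Tendsto (fun t : ℝ => ergodicLimit T (barycenterFlow t β) φ ω) (𝓝[>] 0)
          (𝓝 (ergodicLimit T canonicalBarycenter φ ω))) ∧
      -- convergence of the expectations if `T` is ergodic
      (Ergodic T P →
        Tendsto (fun t : ℝ => barycentricExpectation P (barycenterFlow t β) φ) (𝓝[>] 0)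
          (𝓝 (barycentricExpectation P canonicalBarycenter φ))) := by
  obtain ⟨hdef, hlim⟩ := corollary5p7_general hM P T hT β hβ
  exact ⟨hdef, fun φ hφ => (hlim φ hφ).imp_right (.imp_right (.imp_right fun h _ => h))⟩
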